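/- Let $m\in\mathbb N$ and consider a system $\mathbf y=\mathbf G(x,\mathbf y)$ of $m$ equations $y_i=G_i(x,y_1,\dots,y_m)$, where the $G_i$ are formal power series with real coefficients. All derivatives of power series are formal, $J_{\mathbf G}=(\partial G_i/\partial y_j)_{i,j}$, and a series with nonnegative coefficients is evaluated at points with nonnegative coordinates as a sum in $[0,\infty]$. The system is called *well-conditioned* if (1) all $G_i$ have nonnegative coefficients; (2) $\mathbf G$ is holomorphic in a neighborhood of the origin; (3) $\mathbf G(0,\mathbf y)=\mathbf 0$; (4) $G_i(x,\mathbf 0)\neq 0$ for all $i$; (5) $\det(I-J_{\mathbf G}(0,\mathbf 0))\ne 0$; (6) the system is irreducible, i.e. the directed graph on $\{1,\dots,m\}$ with an edge $i\to j$ whenever $\partial G_i/\partial y_j\neq 0$ is strongly connected; (7) $\partial^2 G_i/\partial y_j\partial y_k\ne 0$ for some $i,j,k$. A *standard solution* is a vector $\mathbf T(x)$ of formal power series with nonnegative coefficients and zero constant terms such that formally $\mathbf T(x)=\mathbf G(x,\mathbf T(x))$. The *extreme point* is the point $(\rho,\boldsymbol\tau)\in\mathbb R^{m+1}$ such that $\rho$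 is the common radius of convergence of the components $T_i$ of the standard solution and $\tau_i=T_i(\rho)<\infty$. The *positive domain* is $\mathsf{Dom}^+(\mathbf G)=\{(a,\mathbf b)\in\mathbb R^{m+1}: a,b_1,\dots,b_m>0,\ G_i(a,\mathbf b)<\infty \text{ for all } i\}$; interior and boundary are taken in $\mathbb R^{m+1}$. At a point $(a,\mathbf b)$ with positive coordinates at which all entries of $J_{\mathbf G}$ converge, $\Lambda(a,\mathbf b)$ denotes the largest real eigenvalue of $J_{\mathbf G}(a,\mathbf b)$. A *characteristic point* is a point $(a,\mathbf b)\in\mathbb R^{m+1}$ with positive coordinates such that $\mathbf b=\mathbf G(a,\mathbf b)$, all entries of $J_{\mathbf G}(a,\mathbf b)$ are finite, and $\det(I-J_{\mathbf G}(a,\mathbf b))=0$. An *eigenpoint* is a characteristic point $(a,\mathbf b)$ with $\Lambda(a,\mathbf b)=1$. **Theorem.** Let $\mathbf y=\mathbf G(x,\mathbf y)$ be a well-conditioned system. Then the extreme point $(\rho,\boldsymbol\tau)$ exists and is unique, and the following hold. (a) $(\rho,\boldsymbol\tau)\in\mathsf{Dom}^+(\mathbf G)$. (b) If $(\rho,\boldsymbol\tau)$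 is in the interior of $\mathsf{Dom}^+(\mathbf G)$, then it is an eigenpoint. (c) The system has at most one eigenpoint. (d) If there is an eigenpoint, then it must be $(\rho,\boldsymbol\tau)$. (e) If there is no eigenpoint, then $(\rho,\boldsymbol\tau)$ lies on the boundary of $\mathsf{Dom}^+(\mathbf G)$, all entries of $J_{\mathbf G}(\rho,\boldsymbol\tau)$ are finite, and $\Lambda(\rho,\boldsymbol\tau)<1$. -/

import Mathlib

open Filter Topology

noncomputable section

namespace RecursiveSystem

/-- The value in `[0, ∞]` of a power series with nonnegative coefficients in `k` variables at a
point of `ℝ ^ k` with nonnegative coordinates. -/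
def evalNN {k : ℕ} (A : MvPowerSeries (Fin k) ℝ) (c : Fin k → ℝ) : ENNReal :=
  ∑' d : Fin k →₀ ℕ, ENNReal.ofReal (MvPowerSeries.coeff d A * ∏ i, c i ^ d i)

/-- The power series `A` converges in a neighbourhood of the origin of `ℂ ^ k`, and its sum is
holomorphic there. -/
def IsHolomorphicNearZero {k : ℕ} (A : MvPowerSeries (Fin k) ℝ) : Prop :=
  ∃ f : (Fin k → ℂ) → ℂ, AnalyticAt ℂ f 0 ∧
    ∀ᶠ z in 𝓝 (0 : Fin k → ℂ),
      HasSum (fun d : Fin k →₀ ℕ => ((MvPowerSeries.coeff d A : ℝ) : ℂ) * ∏ i, z i ^ d i) (f z)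

variable {m : ℕ}

/-
A system `y = G(x, y)` of `m` equations is given by the `m` power series `G i` in `m + 1`
variables: the variable with index `0` is `x`, the variable with index `j.succ` is `y_j`.
Correspondingly a point `(a, b)` of `ℝ ^ (m + 1)` is a function `p : Fin (m + 1) → ℝ`
with `p 0 = a` and `p j.succ = b_j`.
-/

/-- The formal partial derivative `∂ G_i / ∂ y_j`. -/
def partialY (G : Fin m → MvPowerSeries (Fin (m + 1)) ℝ) (i j : Fin m) :
    MvPowerSeries (Fin (m + 1)) ℝ :=
  MvPowerSeries.pderiv ℝ j.succ (G i)

/-- All entries of the Jacobian matrix `(∂ G_i / ∂ y_j)` converge at `p`. -/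
def JacobianFinite (G : Fin m → MvPowerSeries (Fin (m + 1)) ℝ) (p : Fin (m + 1) → ℝ) : Prop :=
  ∀ i j, evalNN (partialY G i j) p < ⊤

/-- The value at `p` of the Jacobian matrix `(∂ G_i / ∂ y_j)`, as a real matrix; it is used only
at points where all entries are finite. -/
def jacobian (G : Fin m → MvPowerSeries (Fin (m + 1)) ℝ) (p : Fin (m + 1) → ℝ) :
    Matrix (Fin m) (Fin m) ℝ :=
  Matrix.of fun i j => (evalNN (partialY G i j) p).toReal

/-- Well-conditioned systems `y = G(x, y)`. -/
structure IsWellConditioned (G : Fin m → MvPowerSeries (Fin (m + 1)) ℝ) : Prop where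
  /-- the coefficients are nonnegative -/
  nonneg : ∀ i d, 0 ≤ MvPowerSeries.coeff d (G i)
  /-- `G` is holomorphic in a neighbourhood of the origin -/
  holomorphic : ∀ i, IsHolomorphicNearZero (G i)
  /-- `G(0, y) = 0`: no monomial free of `x` occurs -/
  zero_left : ∀ i (d : Fin (m + 1) →₀ ℕ), d 0 = 0 → MvPowerSeries.coeff d (G i) = 0
  /-- `G_i(x, 0) ≠ 0`: some monomial free of all `y_j` occurs -/
  zero_right : ∀ i, ∃ n : ℕ, MvPowerSeries.coeff (Finsupp.single 0 n) (G i) ≠ 0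
  /-- `det (I - J_G(0, 0)) ≠ 0` -/
  det_ne_zero : (1 - jacobian G 0).det ≠ 0
  /-- the matrix `J_G` of power series is irreducible: the directed graph with an edge from `i`
  to `j` whenever `∂ G_i / ∂ y_j ≠ 0` is strongly connected -/
  irreducible : ∀ i j : Fin m, Relation.ReflTransGen (fun k l => partialY G k l ≠ 0) i j
  /-- some second partial derivative with respect to the `y` variables is not zero -/
  nonlinear : ∃ i j k : Fin m, MvPowerSeries.pderiv ℝ k.succ (partialY G i j) ≠ 0

/-- `T` is a standard solution: the `T_i` are power series in `x` with nonnegative coefficients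
and zero constant term, and formally `T(x) = G(x, T(x))`. -/
structure IsStandardSolution (G : Fin m → MvPowerSeries (Fin (m + 1)) ℝ)
    (T : Fin m → PowerSeries ℝ) : Prop where
  nonneg : ∀ i n, 0 ≤ PowerSeries.coeff n (T i)
  constantCoeff_eq_zero : ∀ i, PowerSeries.constantCoeff (T i) = 0
  eq_subst : ∀ i, T i =
    MvPowerSeries.subst (Fin.cons PowerSeries.X T : Fin (m + 1) → PowerSeries ℝ) (G i)

/-- The radius of convergence, in `[0, ∞]`, of a power series in one variable. -/
def radius (A : PowerSeries ℝ) : ENNReal :=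
  (FormalMultilinearSeries.ofScalars ℝ (fun n => PowerSeries.coeff n A)).radius

/-- `p = (ρ, τ)` is the extreme point of the system: `ρ` is the common radius of convergence of
the components `T_i` of the standard solution, and `T_i(ρ)` converges to `τ_i`. -/
def IsExtremePoint (G : Fin m → MvPowerSeries (Fin (m + 1)) ℝ) (p : Fin (m + 1) → ℝ) : Prop :=
  ∃ T : Fin m → PowerSeries ℝ, IsStandardSolution G T ∧ 0 ≤ p 0 ∧
    ∀ i, radius (T i) = ENNReal.ofReal (p 0) ∧
      HasSum (fun n => PowerSeries.coeff n (T i) * p 0 ^ n) (p i.succ)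

/-- The positive domain of `G`. -/
def posDomain (G : Fin m → MvPowerSeries (Fin (m + 1)) ℝ) : Set (Fin (m + 1) → ℝ) :=
  {p | (∀ k, 0 < p k) ∧ ∀ i, evalNN (G i) p < ⊤}

/-- Characteristic points: the positive solutions `(a, b)` of the equations `y = G(x, y)` and
`det (I - J_G(x, y)) = 0`, with all series involved convergent. -/
structure IsCharacteristicPoint (G : Fin m → MvPowerSeries (Fin (m + 1)) ℝ)
    (p : Fin (m + 1) → ℝ) : Prop where
  pos : ∀ k, 0 < p k
  solution : ∀ i, evalNN (G i) p = ENNReal.ofReal (p i.succ)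
  jacobianFinite : JacobianFinite G p
  det_eq_zero : (1 - jacobian G p).det = 0

/-- `l = Λ(p)`: the Jacobian matrix is finite at `p` and `l` is its largest real eigenvalue. -/
def IsLambda (G : Fin m → MvPowerSeries (Fin (m + 1)) ℝ) (p : Fin (m + 1) → ℝ) (l : ℝ) : Prop :=
  JacobianFinite G p ∧
    IsGreatest {r : ℝ | Module.End.HasEigenvalue (Matrix.toLin' (jacobian G p)) r} l

/-- Eigenpoints: characteristic points `p` with `Λ(p) = 1`. -/
def IsEigenpoint (G : Fin m → MvPowerSeries (Fin (m + 1)) ℝ) (p : Fin (m + 1) → ℝ) : Prop :=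
  IsCharacteristicPoint G p ∧ IsLambda G p 1

end RecursiveSystem

end

noncomputable section

namespace RecursiveSystem

section Perron

variable {n : Type*} [Fintype n] [DecidableEq n] {A : Matrix n n ℝ}

theorem matrix_pow_nonneg (hA : ∀ i j, 0 ≤ A i j) (k : ℕ) : ∀ i j, 0 ≤ (A ^ k) i j := by
  induction k with
  | zero => intro i j; rw [pow_zero, Matrix.one_apply]; split_ifs <;> norm_num
  | succ k ih =>
    intro i j
    rw [pow_succ, Matrix.mul_apply]
    exact Finset.sum_nonneg fun l _ => mul_nonneg (ih i l) (hA l j)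

theorem exists_matrix_pow_pos (hA : ∀ i j, 0 ≤ A i j) {i j : n}
    (h : Relation.ReflTransGen (fun k l => A k l ≠ 0) i j) : ∃ k : ℕ, 0 < (A ^ k) i j := by
  induction h with
  | refl => exact ⟨0, by simp⟩
  | @tail l j _ hlj ih =>
    obtain ⟨k, hk⟩ := ih
    refine ⟨k + 1, ?_⟩
    rw [pow_succ, Matrix.mul_apply]
    exact Finset.sum_pos' (fun l _ => mul_nonneg (matrix_pow_nonneg hA k i l) (hA l j))
      ⟨l, Finset.mem_univ _, mul_pos hk (lt_of_le_of_ne (hA l j) (Ne.symm hlj))⟩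

/-- A nonnegative irreducible matrix commutes with a matrix all of whose entries are positive. -/
theorem exists_commute_pos (hA : ∀ i j, 0 ≤ A i j)
    (hirr : ∀ i j, Relation.ReflTransGen (fun k l => A k l ≠ 0) i j) :
    ∃ P : Matrix n n ℝ, Commute P A ∧ ∀ i j, 0 < P i j := by
  choose k hk using fun i j => exists_matrix_pow_pos hA (hirr i j)
  refine ⟨∑ ij : n × n, A ^ k ij.1 ij.2, ?_, fun i j => ?_⟩
  · exact Commute.sum_left _ _ _ fun ij _ => (Commute.refl A).pow_left _
  · rw [Matrix.sum_apply]
    exact Finset.sum_pos' (fun ij _ => matrix_pow_nonneg hA _ i j)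
      ⟨(i, j), Finset.mem_univ _, hk i j⟩

omit [DecidableEq n] in
theorem mulVec_pos_of_pos {P : Matrix n n ℝ} (hP : ∀ i j, 0 < P i j) {z : n → ℝ}
    (hz : ∀ i, 0 ≤ z i) (hz' : z ≠ 0) (i : n) : 0 < (P.mulVec z) i := by
  obtain ⟨j, hj⟩ := Function.ne_iff.1 hz'
  exact Finset.sum_pos' (fun l _ => mul_nonneg (hP i l).le (hz l))
    ⟨j, Finset.mem_univ _, mul_pos (hP i j) (lt_of_le_of_ne (hz j) (Ne.symm hj))⟩

theorem exists_pos_eigenvector [Nonempty n] (hA : ∀ i j, 0 ≤ A i j)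
    (hirr : ∀ i j, Relation.ReflTransGen (fun k l => A k l ≠ 0) i j) :
    ∃ (r : ℝ) (v : n → ℝ), (∀ i, 0 < v i) ∧ A.mulVec v = r • v := by
  obtain ⟨P, hPA, hP⟩ := exists_commute_pos hA hirr
  set R : ℝ := ∑ i, ∑ j, A i j
  set K : Set (ℝ × (n → ℝ)) :=
    (Set.Icc 0 R ×ˢ stdSimplex ℝ n) ∩ {x | ∀ i, x.1 * x.2 i ≤ (A.mulVec x.2) i}
  have hK : IsCompact K := by
    refine (isCompact_Icc.prod (isCompact_stdSimplex ℝ n)).inter_right ?_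
    simp only [Set.ofPred_forall]
    refine isClosed_iInter fun i => isClosed_le (by fun_prop) ?_
    simp only [Matrix.mulVec, dotProduct]
    fun_prop
  have hR : 0 ≤ R := Finset.sum_nonneg fun i _ => Finset.sum_nonneg fun j _ => hA i j
  have hbound : ∀ (r : ℝ) (u : n → ℝ), u ∈ stdSimplex ℝ n →
      (∀ i, r * u i ≤ (A.mulVec u) i) → r ≤ R := by
    intro r u hu h
    calc r = ∑ i, r * u i := by rw [← Finset.mul_sum, hu.2, mul_one]
      _ ≤ ∑ i, ∑ j, A i j * u j := Finset.sum_le_sum fun i _ => h i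
      _ ≤ R := by
        refine Finset.sum_le_sum fun i _ => Finset.sum_le_sum fun j _ => ?_
        refine mul_le_of_le_one_right (hA i j) ?_
        rw [← hu.2]
        exact Finset.single_le_sum (fun l _ => hu.1 l) (Finset.mem_univ j)
  have hne : K.Nonempty := by
    obtain ⟨i₀⟩ := ‹Nonempty n›
    refine ⟨(0, Pi.single i₀ 1), ⟨⟨le_rfl, hR⟩, single_mem_stdSimplex ℝ i₀⟩, fun i => ?_⟩
    rw [zero_mul]
    exact Finset.sum_nonneg fun l _ =>
      mul_nonneg (hA i l) ((single_mem_stdSimplex ℝ i₀).1 l)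
  obtain ⟨⟨r, u⟩, ⟨⟨hr, hu⟩, hru⟩, hmax⟩ := hK.exists_isMaxOn hne continuous_fst.continuousOn
  simp only [Set.mem_ofPred_eq] at hru hu hr
  have hu0 : u ≠ 0 := by
    rintro rfl
    have := hu.2
    simp at this
  have hw := mulVec_pos_of_pos hP hu.1 hu0
  have hAw : A.mulVec (P.mulVec u) - r • P.mulVec u = P.mulVec (A.mulVec u - r • u) := by
    rw [Matrix.mulVec_sub, Matrix.mulVec_mulVec, Matrix.mulVec_mulVec, hPA.eq, Matrix.mulVec_smul]
  by_cases hz : A.mulVec u - r • u = 0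
  · refine ⟨r, P.mulVec u, hw, ?_⟩
    rw [hz, Matrix.mulVec_zero] at hAw
    exact sub_eq_zero.1 hAw
  exfalso
  have hz' : ∀ i, 0 < (A.mulVec (P.mulVec u) - r • P.mulVec u) i := by
    intro i
    rw [hAw]
    exact mulVec_pos_of_pos hP (fun i => sub_nonneg.2 (hru i)) hz i
  set w := P.mulVec u
  obtain ⟨i₀, hi₀⟩ := Finite.exists_min fun i => (A.mulVec w - r • w) i / w i
  set ε := (A.mulVec w - r • w) i₀ / w i₀
  have hε : 0 < ε := div_pos (hz' i₀) (hw i₀)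
  have hS : 0 < ∑ i, w i := Finset.sum_pos (fun i _ => hw i) Finset.univ_nonempty
  have hmem : (∑ i, w i)⁻¹ • w ∈ stdSimplex ℝ n := by
    refine ⟨fun i => mul_nonneg (inv_nonneg.2 hS.le) (hw i).le, ?_⟩
    simp only [Pi.smul_apply, smul_eq_mul, ← Finset.mul_sum]
    exact inv_mul_cancel₀ hS.ne'
  have hle : ∀ i, (r + ε) * ((∑ i, w i)⁻¹ • w) i ≤ (A.mulVec ((∑ i, w i)⁻¹ • w)) i := by
    intro i
    rw [Matrix.mulVec_smul]
    simp only [Pi.smul_apply, smul_eq_mul]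
    rw [mul_left_comm]
    refine mul_le_mul_of_nonneg_left ?_ (inv_nonneg.2 hS.le)
    have := (le_div_iff₀ (hw i)).1 (hi₀ i)
    simp only [Pi.sub_apply, Pi.smul_apply, smul_eq_mul] at this
    linarith
  have := hmax (show (r + ε, (∑ i, w i)⁻¹ • w) ∈ K from
    ⟨⟨⟨by linarith [hr.1], hbound _ _ hmem hle⟩, hmem⟩, hle⟩)
  simp only [Set.mem_ofPred_eq] at this
  linarith

/-- The Perron–Frobenius theorem. -/
theorem exists_perron [Nonempty n] (hA : ∀ i j, 0 ≤ A i j)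
    (hirr : ∀ i j, Relation.ReflTransGen (fun k l => A k l ≠ 0) i j) :
    ∃ (r : ℝ) (v u : n → ℝ), (∀ i, 0 < v i) ∧ (∀ i, 0 < u i) ∧ A.mulVec v = r • v ∧
      A.transpose.mulVec u = r • u ∧
      IsGreatest {s : ℝ | Module.End.HasEigenvalue (Matrix.toLin' A) s} r := by
  obtain ⟨r, v, hv, hAv⟩ := exists_pos_eigenvector hA hirr
  have hirr' : ∀ i j, Relation.ReflTransGen (fun k l => A.transpose k l ≠ 0) i j := fun i j => by
    have := (hirr j i).swap
    exact this
  obtain ⟨r', u, hu, hAu⟩ := exists_pos_eigenvector (A := A.transpose) (fun i j => hA j i) hirr'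
  have huv : 0 < u ⬝ᵥ v :=
    Finset.sum_pos (fun i _ => mul_pos (hu i) (hv i)) Finset.univ_nonempty
  have key : ∀ z : n → ℝ, u ⬝ᵥ A.mulVec z = r' * (u ⬝ᵥ z) := fun z => by
    rw [Matrix.dotProduct_mulVec, ← Matrix.mulVec_transpose, hAu, smul_dotProduct, smul_eq_mul]
  have hrr : r = r' := by
    have := key v
    rw [hAv, dotProduct_smul, smul_eq_mul] at this
    exact mul_right_cancel₀ huv.ne' this
  subst hrr
  refine ⟨r, v, u, hv, hu, hAv, hAu, ?_, ?_⟩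
  · refine Module.End.hasEigenvalue_of_hasEigenvector (x := v) ⟨?_, ?_⟩
    · rw [Module.End.mem_eigenspace_iff, Matrix.toLin'_apply, hAv]
    · rintro rfl
      obtain ⟨i⟩ := ‹Nonempty n›
      exact (hv i).ne' rfl
  · rintro s hs
    obtain ⟨z, hz⟩ := hs.exists_hasEigenvector
    have hz1 : A.mulVec z = s • z := by
      have := hz.apply_eq_smul
      rwa [Matrix.toLin'_apply] at this
    have hpos : 0 < u ⬝ᵥ fun i => |z i| := by
      obtain ⟨j, hj⟩ := Function.ne_iff.1 hz.2
      exact Finset.sum_pos' (fun i _ => mul_nonneg (hu i).le (abs_nonneg _))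
        ⟨j, Finset.mem_univ _, mul_pos (hu j) (abs_pos.2 hj)⟩
    have hle : s * (u ⬝ᵥ fun i => |z i|) ≤ r * (u ⬝ᵥ fun i => |z i|) := by
      rw [← key, ← smul_eq_mul, ← dotProduct_smul]
      refine Finset.sum_le_sum fun i _ => mul_le_mul_of_nonneg_left ?_ (hu i).le
      calc s * |z i| ≤ |s| * |z i| := mul_le_mul_of_nonneg_right (le_abs_self s) (abs_nonneg _)
        _ = |(A.mulVec z) i| := by rw [hz1, Pi.smul_apply, smul_eq_mul, abs_mul]
        _ ≤ ∑ j, |A i j * z j| := Finset.abs_sum_le_sum_abs _ _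
        _ = (A.mulVec fun i => |z i|) i :=
          Finset.sum_congr rfl fun j _ => by rw [abs_mul, abs_of_nonneg (hA i j)]
    exact le_of_mul_le_mul_right hle hpos

end Perron

theorem exists_path_bound {n : Type*} {A : n → n → ENNReal} {i j : n}
    (h : Relation.ReflTransGen (fun k l => A k l ≠ 0) i j) :
    ∃ C : ENNReal, C ≠ 0 ∧ ∀ v : n → ENNReal, (∀ k l, A k l * v l ≤ v k) → C * v j ≤ v i := by
  induction h with
  | refl => exact ⟨1, one_ne_zero, fun v _ => by rw [one_mul]⟩
  | @tail l j _ hlj ih =>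
    obtain ⟨C, hC, hCv⟩ := ih
    refine ⟨C * A l j, mul_ne_zero hC hlj, fun v hv => ?_⟩
    rw [mul_assoc]
    exact (mul_le_mul_right (hv l j) C).trans (hCv v hv)

section PolynomialTaylor

open MvPolynomial

variable {σ : Type*} [Fintype σ]

theorem eval_add_expand [DecidableEq σ] (P : MvPolynomial σ ENNReal) (p h : σ → ENNReal)
    (t : ENNReal) (ht : t ≤ 1) :
    ∃ R, eval (p + h) P = eval p P + ∑ k, h k * eval p (pderiv k P) + R ∧
      eval (p + t • h) P ≤ eval p P + t * ∑ k, h k * eval p (pderiv k P) + t ^ 2 * R := by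
  induction P using MvPolynomial.induction_on with
  | C a => exact ⟨0, by simp, by simp⟩
  | add P Q hP hQ =>
    obtain ⟨R, hR, hR'⟩ := hP
    obtain ⟨S, hS, hS'⟩ := hQ
    refine ⟨R + S, ?_, ?_⟩
    · simp only [map_add, hR, hS, mul_add, Finset.sum_add_distrib]
      ring
    · simp only [map_add, mul_add, Finset.sum_add_distrib]
      refine (add_le_add hR' hS').trans (le_of_eq ?_)
      ring
  | mul_X P j hP =>
    obtain ⟨R, hR, hR'⟩ := hP
    have hD : ∑ k, h k * eval p (pderiv k (P * X j)) =
        p j * (∑ k, h k * eval p (pderiv k P)) + h j * eval p P := by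
      simp only [Derivation.leibniz, pderiv_X, smul_eq_mul, map_add, map_mul, eval_X, mul_add,
        Finset.sum_add_distrib]
      rw [add_comm]
      congr 1
      · rw [Finset.mul_sum]
        exact Finset.sum_congr rfl fun k _ => by ring
      · rw [Finset.sum_eq_single j]
        · simp
        · intro k _ hk
          simp [hk.symm]
        · simp
    refine ⟨h j * (∑ k, h k * eval p (pderiv k P)) + (p j + h j) * R, ?_, ?_⟩
    · rw [hD, map_mul, map_mul, eval_X, eval_X, hR, Pi.add_apply]
      ring
    · rw [hD, map_mul, map_mul, eval_X, eval_X, Pi.add_apply, Pi.smul_apply, smul_eq_mul]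
      calc _ ≤ (eval p P + t * ∑ k, h k * eval p (pderiv k P) + t ^ 2 * R) * (p j + t * h j) :=
            mul_le_mul_left hR' _
        _ = eval p P * p j + t * (p j * (∑ k, h k * eval p (pderiv k P)) + h j * eval p P) +
            t ^ 2 * (h j * (∑ k, h k * eval p (pderiv k P)) + (p j + t * h j) * R) := by ring
        _ ≤ _ := by
          gcongr
          exact mul_le_of_le_one_left' ht

theorem eval_add_le [DecidableEq σ] (P : MvPolynomial σ ENNReal) (p h : σ → ENNReal) :
    eval (p + h) P ≤ eval p P + ∑ k, h k * eval (p + h) (pderiv k P) := by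
  induction P using MvPolynomial.induction_on with
  | C a => simp
  | add P Q hP hQ =>
    simp only [map_add, mul_add, Finset.sum_add_distrib]
    refine (add_le_add hP hQ).trans (le_of_eq ?_)
    ring
  | mul_X P j hP =>
    have hD : ∑ k, h k * eval (p + h) (pderiv k (P * X j)) =
        (p j + h j) * (∑ k, h k * eval (p + h) (pderiv k P)) + h j * eval (p + h) P := by
      simp only [Derivation.leibniz, pderiv_X, smul_eq_mul, map_add, map_mul, eval_X, mul_add,
        Finset.sum_add_distrib]
      rw [add_comm]
      congr 1
      · rw [Finset.mul_sum]
        exact Finset.sum_congr rfl fun k _ => by rw [Pi.add_apply]; ring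
      · rw [Finset.sum_eq_single j]
        · simp
        · intro k _ hk
          simp [hk.symm]
        · simp
    rw [hD, map_mul, map_mul, eval_X, eval_X, Pi.add_apply]
    calc _ = p j * eval (p + h) P + h j * eval (p + h) P := by ring
      _ ≤ p j * (eval p P + ∑ k, h k * eval (p + h) (pderiv k P)) + h j * eval (p + h) P := by
        gcongr
      _ = eval p P * p j + (p j * (∑ k, h k * eval (p + h) (pderiv k P)) +
          h j * eval (p + h) P) := by ring
      _ ≤ _ := by
        gcongr
        exact le_self_add

end PolynomialTaylor

section Evaluation

variable {k : ℕ} {A : MvPowerSeries (Fin k) ℝ}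

/-- The value in `[0, ∞]` of a power series with nonnegative coefficients at a point of
`[0, ∞] ^ k`. -/
def ev (A : MvPowerSeries (Fin k) ℝ) (c : Fin k → ENNReal) : ENNReal :=
  ∑' d : Fin k →₀ ℕ, ENNReal.ofReal (MvPowerSeries.coeff d A) * ∏ i, c i ^ d i

theorem evalNN_eq_ev (hA : ∀ d, 0 ≤ MvPowerSeries.coeff d A) {c : Fin k → ℝ}
    (hc : ∀ i, 0 ≤ c i) : evalNN A c = ev A fun i => ENNReal.ofReal (c i) := by
  refine tsum_congr fun d => ?_
  rw [ENNReal.ofReal_mul (hA d), ENNReal.ofReal_prod_of_nonneg fun i _ => pow_nonneg (hc i) _]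
  simp only [ENNReal.ofReal_pow (hc _)]

theorem eval_monomial_one (d : Fin k →₀ ℕ) (c : Fin k → ENNReal) :
    MvPolynomial.eval c (MvPolynomial.monomial d 1) = ∏ i, c i ^ d i := by
  rw [MvPolynomial.eval_monomial, one_mul, Finsupp.prod_fintype _ _ fun i => pow_zero _]

theorem ev_mono (A : MvPowerSeries (Fin k) ℝ) {c c' : Fin k → ENNReal} (h : c ≤ c') :
    ev A c ≤ ev A c' :=
  ENNReal.tsum_le_tsum fun _ =>
    mul_le_mul_right (Finset.prod_le_prod' fun i _ => pow_le_pow_left' (h i) _) _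

theorem ev_ne_zero (hA : ∀ d, 0 ≤ MvPowerSeries.coeff d A) (h0 : A ≠ 0) {c : Fin k → ENNReal}
    (hc : ∀ i, c i ≠ 0) : ev A c ≠ 0 := by
  obtain ⟨d, hd⟩ : ∃ d, MvPowerSeries.coeff d A ≠ 0 := by
    by_contra! h
    exact h0 (MvPowerSeries.ext h)
  intro h
  have := ENNReal.tsum_eq_zero.1 h d
  rcases mul_eq_zero.1 this with h1 | h1
  · exact absurd (ENNReal.ofReal_eq_zero.1 h1) (not_le.2 (lt_of_le_of_ne (hA d) (Ne.symm hd)))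
  · exact Finset.prod_ne_zero_iff.2 (fun i _ => pow_ne_zero _ (hc i)) h1

theorem coeff_pderiv_nonneg (hA : ∀ d, 0 ≤ MvPowerSeries.coeff d A) (j : Fin k)
    (d : Fin k →₀ ℕ) : 0 ≤ MvPowerSeries.coeff d (MvPowerSeries.pderiv ℝ j A) := by
  rw [MvPowerSeries.coeff_pderiv]
  exact mul_nonneg (hA _) (by positivity)

theorem ev_pderiv (hA : ∀ d, 0 ≤ MvPowerSeries.coeff d A) (j : Fin k) (c : Fin k → ENNReal) :
    ev (MvPowerSeries.pderiv ℝ j A) c = ∑' d : Fin k →₀ ℕ, ENNReal.ofReal (MvPowerSeries.coeff d A) *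
      MvPolynomial.eval c (MvPolynomial.pderiv j (MvPolynomial.monomial d 1)) := by
  have hinj : Function.Injective fun d : Fin k →₀ ℕ => d + Finsupp.single j 1 :=
    add_left_injective _
  rw [← hinj.tsum_eq]
  · refine tsum_congr fun d => ?_
    rw [MvPowerSeries.coeff_pderiv, MvPolynomial.pderiv_monomial, ENNReal.ofReal_mul (hA _),
      MvPolynomial.eval_monomial, Finsupp.prod_fintype _ _ fun i => pow_zero _,
      add_tsub_cancel_right, mul_assoc]
    congr 2
    rw [one_mul, Finsupp.add_apply, Finsupp.single_eq_same,
      ← ENNReal.ofReal_natCast]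
    push_cast
    rfl
  · intro d hd
    refine ⟨d - Finsupp.single j 1, ?_⟩
    refine tsub_add_cancel_of_le ?_
    rw [Finsupp.single_le_iff]
    by_contra hlt
    refine hd ?_
    have : d j = 0 := by omega
    simp [MvPolynomial.pderiv_monomial, this]

theorem ev_add_sum_pderiv_le (hA : ∀ d, 0 ≤ MvPowerSeries.coeff d A) (p h : Fin k → ENNReal) :
    ev A p + ∑ j, h j * ev (MvPowerSeries.pderiv ℝ j A) p ≤ ev A (p + h) := by
  simp only [ev_pderiv hA]
  simp only [ev, ← ENNReal.tsum_mul_left]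
  rw [← Summable.tsum_finsetSum fun _ _ => ENNReal.summable, ← ENNReal.tsum_add]
  refine ENNReal.tsum_le_tsum fun d => ?_
  obtain ⟨R, hR, -⟩ := eval_add_expand (MvPolynomial.monomial d 1) p h 1 le_rfl
  rw [← eval_monomial_one, ← eval_monomial_one, hR]
  simp only [mul_add, Finset.mul_sum]
  refine le_trans (le_of_eq ?_) le_self_add
  congr 1
  exact Finset.sum_congr rfl fun j _ => by ring

theorem ev_add_smul_le (hA : ∀ d, 0 ≤ MvPowerSeries.coeff d A) (p h : Fin k → ENNReal)
    {t : ENNReal} (ht : t ≤ 1) :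
    ev A (p + t • h) ≤
      ev A p + t * ∑ j, h j * ev (MvPowerSeries.pderiv ℝ j A) p + t ^ 2 * ev A (p + h) := by
  simp only [ev_pderiv hA]
  simp only [ev, ← ENNReal.tsum_mul_left]
  rw [← Summable.tsum_finsetSum fun _ _ => ENNReal.summable, ← ENNReal.tsum_mul_left,
    ← ENNReal.tsum_add, ← ENNReal.tsum_add]
  refine ENNReal.tsum_le_tsum fun d => ?_
  obtain ⟨R, hR, hR'⟩ := eval_add_expand (MvPolynomial.monomial d 1) p h t ht
  rw [← eval_monomial_one, ← eval_monomial_one, ← eval_monomial_one]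
  have hR1 : R ≤ MvPolynomial.eval (p + h) (MvPolynomial.monomial d 1) := hR ▸ le_add_self
  refine (mul_le_mul_right (hR'.trans (add_le_add_right (mul_le_mul_right hR1 _) _)) _).trans
    (le_of_eq ?_)
  simp only [mul_add, Finset.mul_sum]
  congr 1
  · congr 1
    exact Finset.sum_congr rfl fun j _ => by ring
  · ring

theorem ev_add_le (hA : ∀ d, 0 ≤ MvPowerSeries.coeff d A) (p h : Fin k → ENNReal) :
    ev A (p + h) ≤ ev A p + ∑ j, h j * ev (MvPowerSeries.pderiv ℝ j A) (p + h) := by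
  simp only [ev_pderiv hA]
  simp only [ev, ← ENNReal.tsum_mul_left]
  rw [← Summable.tsum_finsetSum fun _ _ => ENNReal.summable, ← ENNReal.tsum_add]
  refine ENNReal.tsum_le_tsum fun d => ?_
  rw [← eval_monomial_one, ← eval_monomial_one]
  refine (mul_le_mul_right (eval_add_le (MvPolynomial.monomial d 1) p h) _).trans (le_of_eq ?_)
  simp only [mul_add, Finset.mul_sum]
  congr 1
  exact Finset.sum_congr rfl fun j _ => by ring

end Evaluation

section Univariate

variable {S T : PowerSeries ℝ}

/-- The value in `[0, ∞]` of a power series in one variable with nonnegative coefficients. -/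
def sev (S : PowerSeries ℝ) (x : ENNReal) : ENNReal :=
  ∑' n : ℕ, ENNReal.ofReal (PowerSeries.coeff n S) * x ^ n

theorem sev_mono (S : PowerSeries ℝ) : Monotone (sev S) := fun _ _ h =>
  ENNReal.tsum_le_tsum fun _ => mul_le_mul_right (pow_le_pow_left' h _) _

theorem sev_X (x : ENNReal) : sev PowerSeries.X x = x := by
  rw [sev, tsum_eq_single 1]
  · simp
  · intro n hn
    simp [PowerSeries.coeff_X, hn]

theorem sev_one (x : ENNReal) : sev 1 x = 1 := by
  rw [sev, tsum_eq_single 0]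
  · simp
  · intro n hn
    simp [PowerSeries.coeff_one, hn]

theorem sev_mul (hS : ∀ n, 0 ≤ PowerSeries.coeff n S) (hT : ∀ n, 0 ≤ PowerSeries.coeff n T)
    (x : ENNReal) : sev (S * T) x = sev S x * sev T x := by
  simp only [sev]
  rw [← ENNReal.tsum_mul_right]
  simp only [← ENNReal.tsum_mul_left]
  rw [← ENNReal.tsum_prod (f := fun i j => ENNReal.ofReal (PowerSeries.coeff i S) * x ^ i *
      (ENNReal.ofReal (PowerSeries.coeff j T) * x ^ j)),
    ← (Finset.HasAntidiagonal.sigmaAntidiagonalEquivProd (A := ℕ)).tsum_eq, ENNReal.tsum_sigma']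
  refine tsum_congr fun n => ?_
  rw [PowerSeries.coeff_mul, ENNReal.ofReal_sum_of_nonneg fun p _ => mul_nonneg (hS _) (hT _),
    tsum_fintype, Finset.sum_mul, ← Finset.sum_coe_sort]
  refine Finset.sum_congr rfl fun p _ => ?_
  have hp : x ^ n = x ^ (p : ℕ × ℕ).1 * x ^ (p : ℕ × ℕ).2 := by
    rw [← pow_add, Finset.HasAntidiagonal.mem_antidiagonal.1 p.2]
  simp only [Finset.HasAntidiagonal.sigmaAntidiagonalEquivProd_apply]
  rw [ENNReal.ofReal_mul (hS _), hp]
  ring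

theorem coeff_mul_nonneg (hS : ∀ n, 0 ≤ PowerSeries.coeff n S)
    (hT : ∀ n, 0 ≤ PowerSeries.coeff n T) (n : ℕ) : 0 ≤ PowerSeries.coeff n (S * T) := by
  rw [PowerSeries.coeff_mul]
  exact Finset.sum_nonneg fun p _ => mul_nonneg (hS _) (hT _)

theorem coeff_one_nonneg (n : ℕ) : 0 ≤ PowerSeries.coeff n (1 : PowerSeries ℝ) := by
  rw [PowerSeries.coeff_one]
  split_ifs <;> norm_num

theorem coeff_X_nonneg (n : ℕ) : 0 ≤ PowerSeries.coeff n (PowerSeries.X : PowerSeries ℝ) := by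
  rw [PowerSeries.coeff_X]
  split_ifs <;> norm_num

theorem coeff_pow_nonneg_and_sev_pow (hS : ∀ n, 0 ≤ PowerSeries.coeff n S) (x : ENNReal) (k : ℕ) :
    (∀ n, 0 ≤ PowerSeries.coeff n (S ^ k)) ∧ sev (S ^ k) x = sev S x ^ k := by
  induction k with
  | zero => rw [pow_zero, pow_zero]; exact ⟨coeff_one_nonneg, sev_one x⟩
  | succ k ih =>
    rw [pow_succ, pow_succ, sev_mul ih.1 hS, ih.2]
    exact ⟨coeff_mul_nonneg ih.1 hS, rfl⟩

theorem coeff_prod_nonneg_and_sev_prod {ι : Type*} (s : Finset ι) {a : ι → PowerSeries ℝ}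
    (ha : ∀ i n, 0 ≤ PowerSeries.coeff n (a i)) (d : ι → ℕ) (x : ENNReal) :
    (∀ n, 0 ≤ PowerSeries.coeff n (∏ i ∈ s, a i ^ d i)) ∧
      sev (∏ i ∈ s, a i ^ d i) x = ∏ i ∈ s, sev (a i) x ^ d i := by
  classical
  induction s using Finset.induction_on with
  | empty => rw [Finset.prod_empty, Finset.prod_empty]; exact ⟨coeff_one_nonneg, sev_one x⟩
  | insert i s hi ih =>
    have h := coeff_pow_nonneg_and_sev_pow (ha i) x (d i)
    rw [Finset.prod_insert hi, Finset.prod_insert hi, sev_mul h.1 ih.1, ih.2, h.2]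
    exact ⟨coeff_mul_nonneg h.1 ih.1, rfl⟩

variable {k : ℕ} {A : MvPowerSeries (Fin k) ℝ} {a : Fin k → PowerSeries ℝ}

theorem coeff_subst_eq_finsum (ha0 : ∀ i, PowerSeries.constantCoeff (a i) = 0)
    (A : MvPowerSeries (Fin k) ℝ) (n : ℕ) :
    PowerSeries.coeff n (MvPowerSeries.subst a A : PowerSeries ℝ) =
      ∑ᶠ d : Fin k →₀ ℕ, MvPowerSeries.coeff d A * PowerSeries.coeff n (∏ i, a i ^ d i) := by
  have := MvPowerSeries.coeff_subst
    (MvPowerSeries.hasSubst_of_constantCoeff_zero (a := a) ha0) A (Finsupp.single () n)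
  simp only [Finsupp.prod_fintype _ _ fun i => pow_zero (a i)] at this
  exact this

theorem ofReal_coeff_subst (hA : ∀ d, 0 ≤ MvPowerSeries.coeff d A)
    (ha : ∀ i n, 0 ≤ PowerSeries.coeff n (a i)) (ha0 : ∀ i, PowerSeries.constantCoeff (a i) = 0)
    (n : ℕ) : ENNReal.ofReal (PowerSeries.coeff n (MvPowerSeries.subst a A : PowerSeries ℝ)) =
      ∑' d : Fin k →₀ ℕ, ENNReal.ofReal (MvPowerSeries.coeff d A) *
        ENNReal.ofReal (PowerSeries.coeff n (∏ i, a i ^ d i)) := by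
  have hfin := MvPowerSeries.coeff_subst_finite
    (MvPowerSeries.hasSubst_of_constantCoeff_zero (a := a) ha0) A (Finsupp.single () n)
  simp only [Finsupp.prod_fintype _ _ fun i => pow_zero (a i)] at hfin
  change (fun d : Fin k →₀ ℕ => MvPowerSeries.coeff d A *
    PowerSeries.coeff n (∏ i, a i ^ d i)).HasFiniteSupport at hfin
  rw [coeff_subst_eq_finsum ha0, ← tsum_eq_finsum (L := .unconditional _) hfin,
    ENNReal.ofReal_tsum_of_nonneg _ (summable_of_hasFiniteSupport hfin)]
  · exact tsum_congr fun d => ENNReal.ofReal_mul (hA d)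
  · exact fun d => mul_nonneg (hA d) ((coeff_prod_nonneg_and_sev_prod _ ha _ 0).1 n)

theorem coeff_subst_nonneg (hA : ∀ d, 0 ≤ MvPowerSeries.coeff d A)
    (ha : ∀ i n, 0 ≤ PowerSeries.coeff n (a i)) (ha0 : ∀ i, PowerSeries.constantCoeff (a i) = 0)
    (n : ℕ) : 0 ≤ PowerSeries.coeff n (MvPowerSeries.subst a A : PowerSeries ℝ) := by
  rw [coeff_subst_eq_finsum ha0]
  exact finsum_nonneg fun d =>
    mul_nonneg (hA d) ((coeff_prod_nonneg_and_sev_prod _ ha _ 0).1 n)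

theorem sev_subst (hA : ∀ d, 0 ≤ MvPowerSeries.coeff d A)
    (ha : ∀ i n, 0 ≤ PowerSeries.coeff n (a i)) (ha0 : ∀ i, PowerSeries.constantCoeff (a i) = 0)
    (x : ENNReal) :
    sev (MvPowerSeries.subst a A : PowerSeries ℝ) x = ev A fun i => sev (a i) x := by
  rw [sev]
  simp only [ofReal_coeff_subst hA ha ha0, ← ENNReal.tsum_mul_right]
  rw [ENNReal.tsum_comm]
  refine tsum_congr fun d => ?_
  rw [← (coeff_prod_nonneg_and_sev_prod _ ha _ x).2, sev, ← ENNReal.tsum_mul_left]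
  exact tsum_congr fun n => mul_assoc _ _ _

theorem tendsto_sev_nhdsLT (S : PowerSeries ℝ) (x : ENNReal) :
    Tendsto (sev S) (𝓝[<] x) (𝓝 (sev S x)) := by
  refine tendsto_order.2 ⟨fun b hb => ?_, fun b hb => ?_⟩
  · have hlsc : LowerSemicontinuous (sev S) := lowerSemicontinuous_tsum fun n =>
      (ENNReal.continuous_const_mul ENNReal.ofReal_ne_top).comp
        (ENNReal.continuous_pow n) |>.lowerSemicontinuous
    exact (hlsc x b hb).filter_mono nhdsWithin_le_nhds
  · filter_upwards [self_mem_nhdsWithin] with y hy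
    exact (sev_mono S (le_of_lt hy)).trans_lt hb

theorem natCast_mul_sev_le (hS : PowerSeries.constantCoeff S = 0) {N : ℕ} (hN : N ≠ 0)
    (x : ENNReal) : N * sev S x ≤ sev S (N * x) := by
  rw [sev, ← ENNReal.tsum_mul_left]
  refine ENNReal.tsum_le_tsum fun n => ?_
  rcases Nat.eq_zero_or_pos n with rfl | hn
  · simp [hS]
  · rw [mul_left_comm, mul_pow]
    gcongr
    have : (1 : ENNReal) ≤ N := by exact_mod_cast Nat.one_le_iff_ne_zero.2 hN
    exact le_self_pow₀ this hn.ne'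

theorem hasSum_of_sev_ne_top (hS : ∀ n, 0 ≤ PowerSeries.coeff n S) {x : ℝ} (hx : 0 ≤ x)
    (h : sev S (ENNReal.ofReal x) ≠ ⊤) :
    HasSum (fun n => PowerSeries.coeff n S * x ^ n) (sev S (ENNReal.ofReal x)).toReal := by
  have h1 : sev S (ENNReal.ofReal x) = ∑' n, ENNReal.ofReal (PowerSeries.coeff n S * x ^ n) :=
    tsum_congr fun n => by rw [ENNReal.ofReal_mul (hS n), ENNReal.ofReal_pow hx]
  have hsum := ENNReal.summable_toReal (h1 ▸ h)
  have h0 : ∀ n, 0 ≤ PowerSeries.coeff n S * x ^ n := fun n => mul_nonneg (hS n) (pow_nonneg hx n)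
  simp only [ENNReal.toReal_ofReal (h0 _)] at hsum
  rw [h1, ← ENNReal.ofReal_tsum_of_nonneg h0 hsum, ENNReal.toReal_ofReal (tsum_nonneg h0)]
  exact hsum.hasSum

theorem sev_ne_top_of_summable (hS : ∀ n, 0 ≤ PowerSeries.coeff n S) {x : ℝ} (hx : 0 ≤ x)
    (h : Summable fun n => PowerSeries.coeff n S * x ^ n) : sev S (ENNReal.ofReal x) ≠ ⊤ := by
  have h1 : sev S (ENNReal.ofReal x) = ∑' n, ENNReal.ofReal (PowerSeries.coeff n S * x ^ n) :=
    tsum_congr fun n => by rw [ENNReal.ofReal_mul (hS n), ENNReal.ofReal_pow hx]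
  rw [h1]
  exact h.tsum_ofReal_ne_top

theorem sev_ne_top_of_lt_radius (hS : ∀ n, 0 ≤ PowerSeries.coeff n S) {x : ENNReal}
    (hx : x < radius S) : sev S x ≠ ⊤ := by
  lift x to NNReal using hx.ne_top
  have h := FormalMultilinearSeries.summable_norm_mul_pow _ hx
  rw [← ENNReal.ofReal_coe_nnreal]
  refine sev_ne_top_of_summable hS x.2 (h.congr fun n => ?_)
  rw [FormalMultilinearSeries.ofScalars_norm, Real.norm_of_nonneg (hS n)]

theorem le_radius_of_sev_ne_top (hS : ∀ n, 0 ≤ PowerSeries.coeff n S) {x : ENNReal}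
    (hx : x ≠ ⊤) (h : sev S x ≠ ⊤) : x ≤ radius S := by
  lift x to NNReal using hx
  rw [← ENNReal.ofReal_coe_nnreal] at h
  refine FormalMultilinearSeries.le_radius_of_summable _
    ((hasSum_of_sev_ne_top hS x.2 h).summable.congr fun n => ?_)
  rw [FormalMultilinearSeries.ofScalars_norm, Real.norm_of_nonneg (hS n)]
  rfl

end Univariate

section StandardSolution

variable {m : ℕ} {G : Fin m → MvPowerSeries (Fin (m + 1)) ℝ}

theorem constantCoeff_cons {T : Fin m → PowerSeries ℝ}
    (hT : ∀ i, PowerSeries.constantCoeff (T i) = 0) (i : Fin (m + 1)) :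
    PowerSeries.constantCoeff ((Fin.cons PowerSeries.X T : Fin (m + 1) → PowerSeries ℝ) i) = 0 := by
  refine Fin.cases ?_ (fun j => ?_) i
  · simp
  · simpa using hT j

theorem coeff_cons_nonneg {T : Fin m → PowerSeries ℝ}
    (hT : ∀ i n, 0 ≤ PowerSeries.coeff n (T i)) (i : Fin (m + 1)) (n : ℕ) :
    0 ≤ PowerSeries.coeff n ((Fin.cons PowerSeries.X T : Fin (m + 1) → PowerSeries ℝ) i) := by
  refine Fin.cases ?_ (fun j => ?_) i
  · simpa using coeff_X_nonneg n
  · simpa using hT j n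

theorem sev_cons (T : Fin m → PowerSeries ℝ) (x : ENNReal) :
    (fun i => sev ((Fin.cons PowerSeries.X T : Fin (m + 1) → PowerSeries ℝ) i) x) =
      Fin.cons x fun i => sev (T i) x := by
  funext i
  refine Fin.cases ?_ (fun j => ?_) i
  · simp [sev_X]
  · simp

/-- One more coefficient of `G(x, T(x))` than of `T` is determined when `G(0, y) = 0`. -/
theorem coeff_subst_congr {A : MvPowerSeries (Fin (m + 1)) ℝ}
    (hA : ∀ d : Fin (m + 1) →₀ ℕ, d 0 = 0 → MvPowerSeries.coeff d A = 0)
    {S T : Fin m → PowerSeries ℝ} (hS : ∀ i, PowerSeries.constantCoeff (S i) = 0)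
    (hT : ∀ i, PowerSeries.constantCoeff (T i) = 0) {N : ℕ}
    (h : ∀ i, ∀ n < N, PowerSeries.coeff n (S i) = PowerSeries.coeff n (T i)) :
    ∀ n < N + 1,
      PowerSeries.coeff n (MvPowerSeries.subst
        (Fin.cons PowerSeries.X S : Fin (m + 1) → PowerSeries ℝ) A : PowerSeries ℝ) =
      PowerSeries.coeff n (MvPowerSeries.subst
        (Fin.cons PowerSeries.X T : Fin (m + 1) → PowerSeries ℝ) A : PowerSeries ℝ) := by
  intro n hn
  rw [coeff_subst_eq_finsum (constantCoeff_cons hS), coeff_subst_eq_finsum (constantCoeff_cons hT)]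
  refine finsum_congr fun d => ?_
  rcases Nat.eq_zero_or_pos (d 0) with hd | hd
  · rw [hA d hd, zero_mul, zero_mul]
  obtain ⟨e, he⟩ := Nat.exists_eq_succ_of_ne_zero hd.ne'
  congr 1
  simp only [Fin.prod_univ_succ, Fin.cons_zero, Fin.cons_succ, he, pow_succ', mul_assoc]
  cases n with
  | zero => simp
  | succ n =>
    rw [PowerSeries.coeff_succ_X_mul, PowerSeries.coeff_succ_X_mul, ← sub_eq_zero, ← map_sub,
      ← mul_sub]
    refine PowerSeries.X_pow_dvd_iff.1 (Dvd.dvd.mul_left ?_ _) n (Nat.lt_of_succ_lt_succ hn)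
    rw [← Ideal.mem_span_singleton, ← Ideal.Quotient.eq, map_prod, map_prod]
    refine Finset.prod_congr rfl fun i _ => ?_
    rw [map_pow, map_pow]
    congr 1
    rw [Ideal.Quotient.eq, Ideal.mem_span_singleton, PowerSeries.X_pow_dvd_iff]
    intro l hl
    rw [map_sub, h i l hl, sub_self]

/-- The iterates of `T ↦ G(x, T)`, starting from `0`. -/
def picard (G : Fin m → MvPowerSeries (Fin (m + 1)) ℝ) : ℕ → Fin m → PowerSeries ℝ
  | 0 => 0
  | n + 1 => fun i =>
    MvPowerSeries.subst (Fin.cons PowerSeries.X (picard G n) : Fin (m + 1) → PowerSeries ℝ) (G i)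

theorem picard_constantCoeff (hG : IsWellConditioned G) (n : ℕ) :
    ∀ i, PowerSeries.constantCoeff (picard G n i) = 0 := by
  induction n with
  | zero => intro i; simp [picard]
  | succ n ih =>
    intro i
    exact MvPowerSeries.constantCoeff_subst_eq_zero
      (MvPowerSeries.hasSubst_of_constantCoeff_zero (constantCoeff_cons ih)) (constantCoeff_cons ih)
      (by
        rw [← MvPowerSeries.coeff_zero_eq_constantCoeff_apply]
        exact hG.zero_left i 0 rfl)

theorem picard_nonneg (hG : IsWellConditioned G) (n : ℕ) :
    ∀ i l, 0 ≤ PowerSeries.coeff l (picard G n i) := by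
  induction n with
  | zero => intro i l; simp [picard]
  | succ n ih =>
    intro i l
    exact coeff_subst_nonneg (hG.nonneg i) (coeff_cons_nonneg ih)
      (constantCoeff_cons (picard_constantCoeff hG n)) l

theorem coeff_picard_eq (hG : IsWellConditioned G) (N : ℕ) :
    ∀ M, N ≤ M → ∀ i, ∀ n < N,
      PowerSeries.coeff n (picard G M i) = PowerSeries.coeff n (picard G N i) := by
  induction N with
  | zero => intro M _ i n hn; omega
  | succ N ih =>
    intro M hM i
    obtain ⟨M, rfl⟩ : ∃ M', M = M' + 1 := ⟨M - 1, by omega⟩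
    exact coeff_subst_congr (hG.zero_left i) (picard_constantCoeff hG M)
      (picard_constantCoeff hG N) (ih M (by omega))

theorem IsStandardSolution.coeff_eq_picard (hG : IsWellConditioned G) {T : Fin m → PowerSeries ℝ}
    (hT : IsStandardSolution G T) (N : ℕ) :
    ∀ i, ∀ n < N, PowerSeries.coeff n (T i) = PowerSeries.coeff n (picard G N i) := by
  induction N with
  | zero => intro i n hn; omega
  | succ N ih =>
    intro i
    rw [hT.eq_subst i]
    exact coeff_subst_congr (hG.zero_left i) hT.constantCoeff_eq_zero
      (picard_constantCoeff hG N) ih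

theorem IsStandardSolution.unique (hG : IsWellConditioned G) {S T : Fin m → PowerSeries ℝ}
    (hS : IsStandardSolution G S) (hT : IsStandardSolution G T) : S = T := by
  funext i
  ext n
  rw [hS.coeff_eq_picard hG (n + 1) i n n.lt_succ_self,
    hT.coeff_eq_picard hG (n + 1) i n n.lt_succ_self]

theorem exists_isStandardSolution (hG : IsWellConditioned G) :
    ∃ T, IsStandardSolution G T := by
  set T : Fin m → PowerSeries ℝ :=
    fun i => PowerSeries.mk fun n => PowerSeries.coeff n (picard G (n + 1) i) with hTdef
  have hcoeff : ∀ N i, ∀ n < N, PowerSeries.coeff n (T i) = PowerSeries.coeff n (picard G N i) := by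
    intro N i n hn
    rw [hTdef, PowerSeries.coeff_mk, coeff_picard_eq hG (n + 1) N hn i n n.lt_succ_self]
  have h0 : ∀ i, PowerSeries.constantCoeff (T i) = 0 := fun i => by
    rw [← PowerSeries.coeff_zero_eq_constantCoeff_apply, hcoeff 1 i 0 one_pos,
      PowerSeries.coeff_zero_eq_constantCoeff_apply, picard_constantCoeff hG]
  refine ⟨T, fun i n => ?_, h0, fun i => ?_⟩
  · rw [hcoeff (n + 1) i n n.lt_succ_self]
    exact picard_nonneg hG _ i n
  · ext n
    rw [coeff_subst_congr (hG.zero_left i) h0 (picard_constantCoeff hG n) (hcoeff n) n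
      n.lt_succ_self, hcoeff (n + 1) i n n.lt_succ_self]
    rfl

theorem IsStandardSolution.sev_eq (hG : IsWellConditioned G) {T : Fin m → PowerSeries ℝ}
    (hT : IsStandardSolution G T) (x : ENNReal) (i : Fin m) :
    sev (T i) x = ev (G i) (Fin.cons x fun j => sev (T j) x) := by
  conv_lhs => rw [hT.eq_subst i]
  rw [sev_subst (hG.nonneg i) (coeff_cons_nonneg hT.nonneg)
    (constantCoeff_cons hT.constantCoeff_eq_zero), sev_cons]

/-- The standard solution is the least supersolution. -/
theorem IsStandardSolution.sev_le (hG : IsWellConditioned G) {T : Fin m → PowerSeries ℝ}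
    (hT : IsStandardSolution G T) {x : ENNReal} {b : Fin m → ENNReal}
    (hb : ∀ i, ev (G i) (Fin.cons x b) ≤ b i) (i : Fin m) : sev (T i) x ≤ b i := by
  have hpic : ∀ n i, sev (picard G n i) x ≤ b i := by
    intro n
    induction n with
    | zero => intro i; simp [picard, sev]
    | succ n ih =>
      intro i
      rw [picard, sev_subst (hG.nonneg i) (coeff_cons_nonneg (picard_nonneg hG n))
        (constantCoeff_cons (picard_constantCoeff hG n)), sev_cons]
      refine (ev_mono _ ?_).trans (hb i)
      intro j
      refine Fin.cases ?_ (fun j => ?_) j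
      · simp
      · simpa using ih j
  rw [sev, ENNReal.tsum_eq_iSup_nat]
  refine iSup_le fun N => ?_
  rw [Finset.sum_congr rfl fun n hn => by
    rw [hT.coeff_eq_picard hG N i n (Finset.mem_range.1 hn)]]
  exact (ENNReal.sum_le_tsum _).trans (hpic N i)

end StandardSolution

section Estimates

variable {m : ℕ}

/-- The point `(a, b)` of `[0, ∞] ^ (m + 1)`. -/
abbrev pt (a : ENNReal) (b : Fin m → ENNReal) : Fin (m + 1) → ENNReal := Fin.cons a b

theorem pt_add (a a' : ENNReal) (b b' : Fin m → ENNReal) :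
    pt a b + pt a' b' = pt (a + a') (b + b') := by
  funext i
  refine Fin.cases ?_ (fun j => ?_) i <;> simp [pt]

theorem smul_pt (t a : ENNReal) (b : Fin m → ENNReal) : t • pt a b = pt (t * a) (t • b) := by
  funext i
  refine Fin.cases ?_ (fun j => ?_) i <;> simp [pt]

theorem pt_mono {a a' : ENNReal} {b b' : Fin m → ENNReal} (ha : a ≤ a') (hb : ∀ i, b i ≤ b' i) :
    pt a b ≤ pt a' b' := by
  intro i
  refine Fin.cases ?_ (fun j => ?_) i
  · simpa [pt] using ha
  · simpa [pt] using hb j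

theorem pt_ne_zero {a : ENNReal} {b : Fin m → ENNReal} (ha : a ≠ 0) (hb : ∀ i, b i ≠ 0) :
    ∀ i, pt a b i ≠ 0 := by
  intro i
  refine Fin.cases ?_ (fun j => ?_) i
  · simpa [pt] using ha
  · simpa [pt] using hb j

variable {A : MvPowerSeries (Fin (m + 1)) ℝ}

theorem ev_pt_add_le (hA : ∀ d, 0 ≤ MvPowerSeries.coeff d A) (a a' : ENNReal)
    (b h : Fin m → ENNReal) :
    ev A (pt a b) + (a' * ev (MvPowerSeries.pderiv ℝ 0 A) (pt a b) +
      ∑ j, h j * ev (MvPowerSeries.pderiv ℝ j.succ A) (pt a b)) ≤ ev A (pt (a + a') (b + h)) := by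
  have := ev_add_sum_pderiv_le hA (pt a b) (pt a' h)
  rw [pt_add, Fin.sum_univ_succ] at this
  simpa only [pt, Fin.cons_zero, Fin.cons_succ] using this

theorem ev_pt_add_sum_le (hA : ∀ d, 0 ≤ MvPowerSeries.coeff d A) (a : ENNReal)
    (b h : Fin m → ENNReal) :
    ev A (pt a b) + ∑ j, h j * ev (MvPowerSeries.pderiv ℝ j.succ A) (pt a b) ≤
      ev A (pt a (b + h)) := by
  simpa using ev_pt_add_le hA a 0 b h

theorem ev_pt_le_add (hA : ∀ d, 0 ≤ MvPowerSeries.coeff d A) (a : ENNReal)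
    (b h : Fin m → ENNReal) :
    ev A (pt a (b + h)) ≤
      ev A (pt a b) + ∑ j, h j * ev (MvPowerSeries.pderiv ℝ j.succ A) (pt a (b + h)) := by
  have := ev_add_le hA (pt a b) (pt 0 h)
  rw [pt_add, Fin.sum_univ_succ] at this
  simpa only [pt, Fin.cons_zero, Fin.cons_succ, add_zero, zero_mul, zero_add] using this

theorem half_mul_ev_pderiv_le (hA : ∀ d, 0 ≤ MvPowerSeries.coeff d A) (a : ENNReal)
    (b : Fin m → ENNReal) (j : Fin m) :
    2⁻¹ * b j * ev (MvPowerSeries.pderiv ℝ j.succ A) (pt a fun i => 2⁻¹ * b i) ≤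
      ev A (pt a b) := by
  have hb : ((fun i => 2⁻¹ * b i) + fun i => 2⁻¹ * b i : Fin m → ENNReal) = b := by
    funext i
    rw [Pi.add_apply, ← add_mul, ENNReal.inv_two_add_inv_two, one_mul]
  have := ev_pt_add_sum_le hA a (fun i => 2⁻¹ * b i) (fun i => 2⁻¹ * b i)
  rw [hb] at this
  refine le_trans ?_ (le_add_self.trans this)
  exact Finset.single_le_sum (f := fun j => 2⁻¹ * b j *
    ev (MvPowerSeries.pderiv ℝ j.succ A) (pt a fun i => 2⁻¹ * b i)) (fun _ _ => zero_le)
    (Finset.mem_univ j)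

theorem ev_pt_mul_le (hA : ∀ d : Fin (m + 1) →₀ ℕ, d 0 = 0 → MvPowerSeries.coeff d A = 0)
    {t : ENNReal} (ht : t ≤ 1) (a : ENNReal) (b : Fin m → ENNReal) :
    ev A (pt (t * a) b) ≤ t * ev A (pt a b) := by
  simp only [ev, ← ENNReal.tsum_mul_left]
  refine ENNReal.tsum_le_tsum fun d => ?_
  rcases Nat.eq_zero_or_pos (d 0) with hd | hd
  · simp [hA d hd]
  · rw [mul_left_comm]
    refine mul_le_mul_right ?_ _
    simp only [pt, Fin.prod_univ_succ, Fin.cons_zero, Fin.cons_succ]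
    rw [mul_pow, ← mul_assoc]
    gcongr
    exact pow_le_of_le_one zero_le ht hd.ne'

/-- A matrix cannot strictly decrease one positive vector and fail to decrease another one. -/
theorem not_subinvariant {n : Type*} [Fintype n] [Nonempty n] {B : n → n → ENNReal}
    {u w : n → ENNReal} (hu : ∀ i, ∑ j, u j * B i j < u i) (hu' : ∀ i, u i ≠ ⊤)
    (hw0 : ∀ i, w i ≠ 0) (hw' : ∀ i, w i ≠ ⊤) (hw : ∀ i, w i ≤ ∑ j, w j * B i j) : False := by
  have hu0 : ∀ i, u i ≠ 0 := fun i => (zero_le.trans_lt (hu i)).ne'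
  obtain ⟨i, hi⟩ := Finite.exists_max fun i => w i / u i
  have hle : ∀ j, w j ≤ w i / u i * u j := fun j =>
    (ENNReal.div_le_iff (hu0 j) (hu' j)).1 (hi j)
  have h0 : w i / u i ≠ 0 := ENNReal.div_ne_zero.2 ⟨hw0 i, hu' i⟩
  have ht : w i / u i ≠ ⊤ := ENNReal.div_ne_top (hw' i) (hu0 i)
  have : w i < w i := calc
    w i ≤ ∑ j, w j * B i j := hw i
    _ ≤ ∑ j, w i / u i * u j * B i j :=
      Finset.sum_le_sum fun j _ => mul_le_mul_left (hle j) _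
    _ = w i / u i * ∑ j, u j * B i j := by
      rw [Finset.mul_sum]
      exact Finset.sum_congr rfl fun j _ => mul_assoc _ _ _
    _ < w i / u i * u i := (ENNReal.mul_lt_mul_iff_right h0 ht).2 (hu i)
    _ = w i := ENNReal.div_mul_cancel (hu0 i) (hu' i)
  exact lt_irrefl _ this

end Estimates

section System

variable {m : ℕ} {G : Fin m → MvPowerSeries (Fin (m + 1)) ℝ} {T : Fin m → PowerSeries ℝ}

theorem IsWellConditioned.partialY_nonneg (hG : IsWellConditioned G) (i j : Fin m)
    (d : Fin (m + 1) →₀ ℕ) : 0 ≤ MvPowerSeries.coeff d (partialY G i j) :=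
  coeff_pderiv_nonneg (hG.nonneg i) _ d

theorem IsWellConditioned.nonempty (hG : IsWellConditioned G) : Nonempty (Fin m) :=
  ⟨hG.nonlinear.choose⟩

theorem IsWellConditioned.pderiv_zero_ne_zero (hG : IsWellConditioned G) (i : Fin m) :
    MvPowerSeries.pderiv ℝ 0 (G i) ≠ 0 := by
  obtain ⟨n, hn⟩ := hG.zero_right i
  cases n with
  | zero => exact absurd (hG.zero_left i _ (by simp)) hn
  | succ n =>
    intro h
    have := MvPowerSeries.coeff_pderiv (R := ℝ) (i := (0 : Fin (m + 1))) (G i) (Finsupp.single 0 n)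
    rw [h, map_zero, ← Finsupp.single_add] at this
    refine mul_ne_zero hn ?_ this.symm
    positivity

theorem IsStandardSolution.sev_ne_zero (hG : IsWellConditioned G) (hT : IsStandardSolution G T)
    {x : ENNReal} (hx : x ≠ 0) (i : Fin m) : sev (T i) x ≠ 0 := by
  obtain ⟨n, hn⟩ := hG.zero_right i
  rw [hT.sev_eq hG]
  intro h
  have := ENNReal.tsum_eq_zero.1 h (Finsupp.single 0 n)
  rw [Fin.prod_univ_succ] at this
  simp only [Fin.cons_zero, Finsupp.single_eq_same] at this
  rw [Finset.prod_eq_one fun j _ => by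
    rw [Finsupp.single_eq_of_ne (Fin.succ_ne_zero j), pow_zero], mul_one] at this
  exact mul_ne_zero (ENNReal.ofReal_pos.2 (lt_of_le_of_ne (hG.nonneg i _) (Ne.symm hn))).ne'
    (pow_ne_zero n hx) this

theorem IsStandardSolution.exists_comparison (hG : IsWellConditioned G)
    (hT : IsStandardSolution G T) {x₀ : ENNReal} (hx₀ : x₀ ≠ 0) (i j : Fin m) :
    ∃ C : ENNReal, C ≠ 0 ∧ ∀ x, x₀ ≤ x → C * sev (T j) x ≤ sev (T i) x := by
  set A₀ : Fin m → Fin m → ENNReal := fun k l =>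
    2⁻¹ * ev (partialY G k l) (pt x₀ fun i => 2⁻¹ * sev (T i) x₀)
  have hpath : Relation.ReflTransGen (fun k l => A₀ k l ≠ 0) i j :=
    (hG.irreducible i j).lift id fun k l hkl => mul_ne_zero (by simp)
      (ev_ne_zero (hG.partialY_nonneg k l) hkl
        (pt_ne_zero hx₀ fun i => mul_ne_zero (by simp) (hT.sev_ne_zero hG hx₀ i)))
  obtain ⟨C, hC, hCv⟩ := exists_path_bound hpath
  refine ⟨C, hC, fun x hx => hCv (fun i => sev (T i) x) fun k l => ?_⟩
  calc A₀ k l * sev (T l) x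
      ≤ 2⁻¹ * ev (partialY G k l) (pt x fun i => 2⁻¹ * sev (T i) x) * sev (T l) x := by
        refine mul_le_mul_left (mul_le_mul_right (ev_mono _ (pt_mono hx fun i => ?_)) _) _
        exact mul_le_mul_right (sev_mono _ hx) _
    _ = 2⁻¹ * sev (T l) x * ev (partialY G k l) (pt x fun i => 2⁻¹ * sev (T i) x) := by ring
    _ ≤ ev (G k) (pt x fun i => sev (T i) x) := half_mul_ev_pderiv_le (hG.nonneg k) _ _ _
    _ = sev (T k) x := (hT.sev_eq hG x k).symm

theorem IsStandardSolution.sev_ne_top_of_ne_top (hG : IsWellConditioned G)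
    (hT : IsStandardSolution G T) {x : ENNReal} {i : Fin m} (h : sev (T i) x ≠ ⊤) (j : Fin m) :
    sev (T j) x ≠ ⊤ := by
  rcases eq_or_ne x 0 with rfl | hx
  · have h0 : sev (T j) 0 = 0 := ENNReal.tsum_eq_zero.2 fun n => by
      cases n with
      | zero => simp [hT.constantCoeff_eq_zero j]
      | succ n => simp
    simp [h0]
  · obtain ⟨C, hC, hle⟩ := hT.exists_comparison hG hx i j
    intro htop
    refine h (top_le_iff.1 ((hle x le_rfl).trans' ?_))
    rw [htop, ENNReal.mul_top hC]

theorem IsStandardSolution.exists_bound (hG : IsWellConditioned G) (hT : IsStandardSolution G T)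
    {x₀ : ENNReal} (hx₀ : x₀ ≠ 0) :
    ∃ (i : Fin m) (B : ENNReal), B ≠ ⊤ ∧ ∀ x, x₀ ≤ x → sev (T i) x ≠ ⊤ → sev (T i) x ≤ B := by
  obtain ⟨i, j, k, hijk⟩ := hG.nonlinear
  obtain ⟨C, hC, hCle⟩ := hT.exists_comparison hG hx₀ j i
  obtain ⟨D, hD, hDle⟩ := hT.exists_comparison hG hx₀ k i
  set c := ev (MvPowerSeries.pderiv ℝ k.succ (partialY G i j))
    (pt x₀ fun l => 2⁻¹ * (2⁻¹ * sev (T l) x₀))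
  have hc : c ≠ 0 := ev_ne_zero (coeff_pderiv_nonneg (hG.partialY_nonneg i j) _) hijk
    (pt_ne_zero hx₀ fun l => mul_ne_zero (by simp)
      (mul_ne_zero (by simp) (hT.sev_ne_zero hG hx₀ l)))
  set E := 2⁻¹ * (2⁻¹ * (2⁻¹ * (C * D * c)))
  have hE : E ≠ 0 := by
    have h2 : (2⁻¹ : ENNReal) ≠ 0 := by simp
    exact mul_ne_zero h2 (mul_ne_zero h2 (mul_ne_zero h2 (mul_ne_zero (mul_ne_zero hC hD) hc)))
  refine ⟨i, E⁻¹, ENNReal.inv_ne_top.2 hE, fun x hx htop => ?_⟩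
  have h0 : sev (T i) x ≠ 0 := hT.sev_ne_zero hG (ne_bot_of_le_ne_bot hx₀ hx) i
  have h1 : E * sev (T i) x * sev (T i) x ≤ 1 * sev (T i) x := calc
    E * sev (T i) x * sev (T i) x
        = 2⁻¹ * (C * sev (T i) x) * (2⁻¹ * (2⁻¹ * (D * sev (T i) x)) * c) := by ring
      _ ≤ 2⁻¹ * sev (T j) x * (2⁻¹ * (2⁻¹ * sev (T k) x) *
          ev (MvPowerSeries.pderiv ℝ k.succ (partialY G i j))
            (pt x fun l => 2⁻¹ * (2⁻¹ * sev (T l) x))) := by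
        gcongr
        · exact hCle x hx
        · exact hDle x hx
        · refine ev_mono _ (pt_mono hx fun l => ?_)
          exact mul_le_mul_right (mul_le_mul_right (sev_mono _ hx) _) _
      _ ≤ 2⁻¹ * sev (T j) x * ev (partialY G i j) (pt x fun l => 2⁻¹ * sev (T l) x) :=
        mul_le_mul_right (half_mul_ev_pderiv_le (hG.partialY_nonneg i j) _ _ _) _
      _ ≤ ev (G i) (pt x fun l => sev (T l) x) := half_mul_ev_pderiv_le (hG.nonneg i) _ _ _
      _ = 1 * sev (T i) x := by rw [one_mul]; exact (hT.sev_eq hG x i).symm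
  have h2 := (ENNReal.mul_le_mul_iff_left h0 htop).1 h1
  rw [ENNReal.le_inv_iff_mul_le, mul_comm]
  exact h2

theorem IsWellConditioned.exists_ev_ne_top (hG : IsWellConditioned G) :
    ∃ r : ENNReal, r ≠ 0 ∧ r ≠ ⊤ ∧ ∀ i, ev (G i) (fun _ => r) ≠ ⊤ := by
  have hev : ∀ i, ∀ᶠ r : ℝ in 𝓝[>] 0, Summable fun d : Fin (m + 1) →₀ ℕ =>
      ((MvPowerSeries.coeff d (G i) : ℝ) : ℂ) * ∏ k, ((r : ℂ)) ^ d k := by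
    intro i
    obtain ⟨f, -, hf⟩ := hG.holomorphic i
    have hcont : Tendsto (fun r : ℝ => fun _ : Fin (m + 1) => (r : ℂ)) (𝓝[>] 0) (𝓝 0) := by
      have : Continuous fun r : ℝ => fun _ : Fin (m + 1) => (r : ℂ) := by fun_prop
      have h := this.tendsto 0
      simp only [Complex.ofReal_zero] at h
      exact h.mono_left nhdsWithin_le_nhds
    filter_upwards [hcont.eventually hf] with r hr
    exact hr.summable
  obtain ⟨r, hr, hpos⟩ := ((eventually_all.2 hev).and self_mem_nhdsWithin).exists
  have hpos : 0 < r := hpos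
  refine ⟨ENNReal.ofReal r, (ENNReal.ofReal_pos.2 hpos).ne', ENNReal.ofReal_ne_top, fun i => ?_⟩
  rw [← evalNN_eq_ev (hG.nonneg i) (c := fun _ => r) fun _ => hpos.le]
  have hsum : Summable fun d : Fin (m + 1) →₀ ℕ =>
      MvPowerSeries.coeff d (G i) * ∏ k, r ^ d k := by
    have := hr i
    exact_mod_cast this
  exact hsum.tsum_ofReal_ne_top

theorem IsStandardSolution.exists_sev_ne_top (hG : IsWellConditioned G)
    (hT : IsStandardSolution G T) : ∃ x : ENNReal, x ≠ 0 ∧ x ≠ ⊤ ∧ ∀ i, sev (T i) x ≠ ⊤ := by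
  obtain ⟨r, hr0, hr, hev⟩ := hG.exists_ev_ne_top
  set M := ∑ i, ev (G i) (fun _ => r) + r
  have hM : M ≠ ⊤ := ENNReal.add_ne_top.2 ⟨ENNReal.sum_ne_top.2 fun i _ => hev i, hr⟩
  have hM0 : M ≠ 0 := fun h => hr0 (add_eq_zero.1 h).2
  have ht : r / M ≤ 1 := ENNReal.div_le_of_le_mul (by rw [one_mul]; exact le_add_self)
  refine ⟨r / M * r, mul_ne_zero (ENNReal.div_ne_zero.2 ⟨hr0, hM⟩) hr0,
    ENNReal.mul_ne_top (ENNReal.div_ne_top hr hM0) hr, fun i => ?_⟩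
  refine ne_top_of_le_ne_top hr (hT.sev_le hG (b := fun _ => r) (fun i => ?_) i)
  have hconst : (pt r fun _ => r : Fin (m + 1) → ENNReal) = fun _ => r := by
    funext i
    refine Fin.cases ?_ (fun j => ?_) i <;> simp [pt]
  calc ev (G i) (pt (r / M * r) fun _ => r) ≤ r / M * ev (G i) (pt r fun _ => r) :=
        ev_pt_mul_le (hG.zero_left i) ht _ _
    _ ≤ r / M * M := by
        rw [hconst]
        gcongr
        exact (Finset.single_le_sum (f := fun i => ev (G i) fun _ => r) (fun _ _ => zero_le)
          (Finset.mem_univ i)).trans le_self_add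
    _ = r := ENNReal.div_mul_cancel hM0 hM

theorem nhdsLT_neBot_of_ne_zero {x : ENNReal} (hx : x ≠ 0) : (𝓝[<] x).NeBot :=
  nhdsLT_neBot_of_exists_lt ⟨0, pos_iff_ne_zero.2 hx⟩

/-- The components of the standard solution have a common positive finite radius of convergence,
at which they converge. -/
theorem IsStandardSolution.exists_radius (hG : IsWellConditioned G)
    (hT : IsStandardSolution G T) : ∃ ρ : ENNReal, ρ ≠ 0 ∧ ρ ≠ ⊤ ∧ (∀ i, radius (T i) = ρ) ∧
      ∀ i, sev (T i) ρ ≠ ⊤ := by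
  obtain ⟨x₀, hx₀, hx₀', hfin⟩ := hT.exists_sev_ne_top hG
  have hle : ∀ i j, radius (T i) ≤ radius (T j) := fun i j => by
    refine le_of_forall_lt_imp_le_of_dense fun x hx => ?_
    exact le_radius_of_sev_ne_top (hT.nonneg j) hx.ne_top
      (hT.sev_ne_top_of_ne_top hG (sev_ne_top_of_lt_radius (hT.nonneg i) hx) j)
  obtain ⟨i, B, hB, hbound⟩ := hT.exists_bound hG hx₀
  have hx₀ρ : x₀ ≤ radius (T i) := le_radius_of_sev_ne_top (hT.nonneg i) hx₀' (hfin i)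
  have hρ0 : radius (T i) ≠ 0 := ne_bot_of_le_ne_bot hx₀ hx₀ρ
  have hbound' : sev (T i) (radius (T i)) ≤ B := by
    have := nhdsLT_neBot_of_ne_zero hρ0
    refine le_of_tendsto (tendsto_sev_nhdsLT (T i) _) ?_
    filter_upwards [self_mem_nhdsWithin] with x hx
    have hx' : x < radius (T i) := hx
    refine (sev_mono _ (le_max_left x x₀)).trans ?_
    rcases le_or_gt x x₀ with h | h
    · rw [max_eq_right h]
      exact hbound _ le_rfl (hfin i)
    · rw [max_eq_left h.le]
      exact hbound _ h.le (sev_ne_top_of_lt_radius (hT.nonneg i) hx')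
  refine ⟨radius (T i), hρ0, fun htop => ?_, fun j => le_antisymm (hle j i) (hle i j),
    hT.sev_ne_top_of_ne_top hG (ne_top_of_le_ne_top hB hbound')⟩
  have h0 := hT.sev_ne_zero hG hx₀ i
  obtain ⟨N, hN⟩ := ENNReal.exists_nat_mul_gt h0 hB
  refine absurd hN (not_lt.2 ?_)
  have hN0 : N ≠ 0 := by rintro rfl; simp at hN
  refine (natCast_mul_sev_le (hT.constantCoeff_eq_zero i) hN0 x₀).trans
    ((sev_mono _ le_top).trans ?_)
  rwa [htop] at hbound'

end System

section Extreme

variable {m : ℕ} {G : Fin m → MvPowerSeries (Fin (m + 1)) ℝ} {T : Fin m → PowerSeries ℝ}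

/-- The increments of the standard solution are strictly subinvariant for the Jacobian matrix. -/
theorem IsStandardSolution.sum_increment_lt (hG : IsWellConditioned G)
    (hT : IsStandardSolution G T) {x y : ENNReal} (hx : x ≠ 0) (hxy : x < y)
    (hy : ∀ i, sev (T i) y ≠ ⊤) (i : Fin m) :
    ∑ j, (sev (T j) y - sev (T j) x) * ev (partialY G i j) (pt x fun j => sev (T j) x) <
      sev (T i) y - sev (T i) x := by
  have hadd : ∀ j, sev (T j) x + (sev (T j) y - sev (T j) x) = sev (T j) y := fun j =>
    add_tsub_cancel_of_le (sev_mono _ hxy.le)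
  have hxt : ∀ j, sev (T j) x ≠ ⊤ := fun j => ne_top_of_le_ne_top (hy j) (sev_mono _ hxy.le)
  have h := ev_pt_add_le (hG.nonneg i) x (y - x) (fun j => sev (T j) x)
    fun j => sev (T j) y - sev (T j) x
  have hfun : ((fun j => sev (T j) x) + fun j => sev (T j) y - sev (T j) x : Fin m → ENNReal) =
      fun j => sev (T j) y := funext hadd
  rw [hfun, add_tsub_cancel_of_le hxy.le, ← hT.sev_eq hG, ← hT.sev_eq hG, ← hadd i] at h
  have h' := (ENNReal.add_le_add_iff_left (hxt i)).1 h
  have hpos : (y - x) * ev (MvPowerSeries.pderiv ℝ 0 (G i)) (pt x fun j => sev (T j) x) ≠ 0 :=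
    mul_ne_zero (tsub_pos_of_lt hxy).ne' (ev_ne_zero (coeff_pderiv_nonneg (hG.nonneg i) _)
      (hG.pderiv_zero_ne_zero i) (pt_ne_zero hx (hT.sev_ne_zero hG hx)))
  refine lt_of_lt_of_le ?_ ((add_comm _ _).trans_le h')
  refine ENNReal.lt_add_right (ne_top_of_le_ne_top ?_ (le_add_self.trans h')) hpos
  exact ENNReal.sub_ne_top (hy i)

theorem tendsto_ev_partialY (hG : IsWellConditioned G) (hT : IsStandardSolution G T) (i j : Fin m)
    (ρ : ENNReal) :
    Tendsto (fun x => ev (partialY G i j) (pt x fun l => sev (T l) x)) (𝓝[<] ρ)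
      (𝓝 (ev (partialY G i j) (pt ρ fun l => sev (T l) ρ))) := by
  have h := tendsto_sev_nhdsLT (MvPowerSeries.subst
    (Fin.cons PowerSeries.X T : Fin (m + 1) → PowerSeries ℝ) (partialY G i j)) ρ
  have heq : ∀ x, sev (MvPowerSeries.subst
      (Fin.cons PowerSeries.X T : Fin (m + 1) → PowerSeries ℝ) (partialY G i j)) x =
      ev (partialY G i j) (pt x fun l => sev (T l) x) := fun x => by
    rw [sev_subst (hG.partialY_nonneg i j) (coeff_cons_nonneg hT.nonneg)
      (constantCoeff_cons hT.constantCoeff_eq_zero), sev_cons]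
  rw [← heq]
  exact h.congr heq

theorem IsStandardSolution.ev_partialY_ne_top (hG : IsWellConditioned G)
    (hT : IsStandardSolution G T) {ρ : ENNReal} (hρ : ρ ≠ 0) (hfin : ∀ i, sev (T i) ρ ≠ ⊤)
    (i j : Fin m) : ev (partialY G i j) (pt ρ fun l => sev (T l) ρ) ≠ ⊤ := by
  have := nhdsLT_neBot_of_ne_zero hρ
  obtain ⟨x₀, hx₀, hx₀ρ⟩ := exists_between (pos_iff_ne_zero.2 hρ)
  have hpath : Relation.ReflTransGen (fun k l =>
      ev (partialY G k l) (pt x₀ fun l => sev (T l) x₀) ≠ 0) j i :=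
    (hG.irreducible j i).lift id fun k l hkl => ev_ne_zero (hG.partialY_nonneg k l) hkl
      (pt_ne_zero hx₀.ne' (hT.sev_ne_zero hG hx₀.ne'))
  obtain ⟨C, hC, hCv⟩ := exists_path_bound hpath
  refine ne_top_of_le_ne_top (ENNReal.inv_ne_top.2 hC)
    (le_of_tendsto (tendsto_ev_partialY hG hT i j ρ) ?_)
  filter_upwards [self_mem_nhdsWithin, Ioo_mem_nhdsLT hx₀ρ] with x hx hx'
  set v : Fin m → ENNReal := fun l => sev (T l) ρ - sev (T l) x
  have hlt := hT.sum_increment_lt hG (hx₀.trans hx'.1).ne' hx hfin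
  have hentry : ∀ k l, ev (partialY G k l) (pt x fun l => sev (T l) x) * v l ≤ v k := fun k l => by
    refine le_trans ?_ (hlt k).le
    rw [mul_comm]
    exact Finset.single_le_sum (f := fun l => v l *
      ev (partialY G k l) (pt x fun l => sev (T l) x)) (fun _ _ => zero_le) (Finset.mem_univ l)
  have hCvx := hCv v fun k l => (mul_le_mul_left (ev_mono _
    (pt_mono hx'.1.le fun l => sev_mono _ hx'.1.le)) _).trans (hentry k l)
  have hvj : v j ≠ 0 := (zero_le.trans_lt (hlt j)).ne'
  have hvj' : v j ≠ ⊤ := ENNReal.sub_ne_top (hfin j)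
  rw [ENNReal.le_inv_iff_mul_le, ← ENNReal.mul_le_mul_iff_left hvj hvj', one_mul]
  calc _ = C * (ev (partialY G i j) (pt x fun l => sev (T l) x) * v j) := by ring
    _ ≤ C * v i := mul_le_mul_right (hentry i j) _
    _ ≤ v j := hCvx

theorem IsStandardSolution.exists_sum_mul_ev_partialY_le (hG : IsWellConditioned G)
    (hT : IsStandardSolution G T) {ρ : ENNReal} (hρ : ρ ≠ 0) (hfin : ∀ i, sev (T i) ρ ≠ ⊤)
    {w : Fin m → ENNReal} (hw0 : ∀ i, w i ≠ 0) (hw' : ∀ i, w i ≠ ⊤) :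
    ∃ i, ∑ j, w j * ev (partialY G i j) (pt ρ fun l => sev (T l) ρ) ≤ w i := by
  by_contra! hlt
  have := nhdsLT_neBot_of_ne_zero hρ
  have := hG.nonempty
  have htend : ∀ i, Tendsto (fun x => ∑ j, w j * ev (partialY G i j) (pt x fun l => sev (T l) x))
      (𝓝[<] ρ) (𝓝 (∑ j, w j * ev (partialY G i j) (pt ρ fun l => sev (T l) ρ))) := fun i =>
    tendsto_finsetSum _ fun j _ =>
      ENNReal.Tendsto.const_mul (tendsto_ev_partialY hG hT i j ρ) (Or.inr (hw' j))
  have hev := eventually_all.2 fun i => (htend i).eventually (lt_mem_nhds (hlt i))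
  obtain ⟨x, hx, hxlt, hxpos⟩ := (hev.and ((eventually_mem_nhdsWithin (a := ρ)).and
    (Ioo_mem_nhdsLT (pos_iff_ne_zero.2 hρ)))).exists
  exact not_subinvariant (hT.sum_increment_lt hG hxpos.1.ne' hxlt hfin)
    (fun i => ENNReal.sub_ne_top (hfin i)) hw0 hw' fun i => (hx i).le

/-- A standard solution extends beyond a point at which the linearization is a contraction and
`G` converges in a neighbourhood. -/
theorem IsStandardSolution.exists_gt_sev_ne_top (hG : IsWellConditioned G)
    (hT : IsStandardSolution G T) {ρ s : ENNReal} (hρ : ρ ≠ ⊤) (hs : s ≠ 0) (hs' : s ≠ ⊤)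
    (hfin : ∀ i, sev (T i) ρ ≠ ⊤) {w : Fin m → ENNReal} (hw' : ∀ i, w i ≠ ⊤)
    (hev : ∀ i, ev (G i) (pt (ρ + s) fun j => sev (T j) ρ + s * w j) ≠ ⊤)
    (hw : ∀ i, ∑ j, w j * ev (partialY G i j) (pt ρ fun l => sev (T l) ρ) < w i) :
    ∃ y, ρ < y ∧ y ≠ ⊤ ∧ ∀ i, sev (T i) y ≠ ⊤ := by
  set F : Fin m → ENNReal := fun i => ev (G i) (pt (ρ + s) fun j => sev (T j) ρ + s * w j)
  have htend : ∀ i, Tendsto (fun t : ENNReal =>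
      s * ∑ j, w j * ev (partialY G i j) (pt ρ fun l => sev (T l) ρ) + t * (2 * F i)) (𝓝[>] 0)
      (𝓝 (s * ∑ j, w j * ev (partialY G i j) (pt ρ fun l => sev (T l) ρ) + 0 * (2 * F i))) :=
    fun i => tendsto_const_nhds.add (ENNReal.Tendsto.mul_const
      (tendsto_id.mono_left nhdsWithin_le_nhds) (Or.inr (ENNReal.mul_ne_top (by simp) (hev i))))
  have hevt : ∀ᶠ t : ENNReal in 𝓝[>] 0, ∀ i,
      s * ∑ j, w j * ev (partialY G i j) (pt ρ fun l => sev (T l) ρ) + t * (2 * F i) < s * w i := by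
    refine eventually_all.2 fun i => (htend i).eventually (gt_mem_nhds ?_)
    rw [zero_mul, add_zero]
    exact (ENNReal.mul_lt_mul_iff_right hs hs').2 (hw i)
  have hneBot : (𝓝[>] (0 : ENNReal)).NeBot := nhdsGT_neBot_of_exists_gt ⟨1, one_pos⟩
  obtain ⟨t, ht, ht1⟩ := (hevt.and (Ioo_mem_nhdsGT one_pos)).exists
  have ht' : t ≠ ⊤ := ht1.2.ne_top
  have hst : s * t ≤ s := mul_le_of_le_one_right' ht1.2.le
  refine ⟨ρ + t * (s * t), ENNReal.lt_add_right hρ (mul_ne_zero ht1.1.ne' (mul_ne_zero hs ht1.1.ne')),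
    ENNReal.add_ne_top.2 ⟨hρ, ENNReal.mul_ne_top ht' (ENNReal.mul_ne_top hs' ht')⟩, fun i => ?_⟩
  refine ne_top_of_le_ne_top (b := sev (T i) ρ + t * (s * w i)) (ENNReal.add_ne_top.2 ⟨hfin i,
    ENNReal.mul_ne_top ht' (ENNReal.mul_ne_top hs' (hw' i))⟩)
    (hT.sev_le hG (b := fun i => sev (T i) ρ + t * (s * w i)) (fun i => ?_) i)
  have hle := ev_add_smul_le (hG.nonneg i) (pt ρ fun l => sev (T l) ρ)
    (pt (s * t) fun j => s * w j) ht1.2.le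
  rw [smul_pt, pt_add, pt_add, Fin.sum_univ_succ] at hle
  simp only [pt, Fin.cons_zero, Fin.cons_succ] at hle
  have hX : s * ev (MvPowerSeries.pderiv ℝ 0 (G i)) (pt ρ fun l => sev (T l) ρ) ≤ F i :=
    (le_self_add.trans le_add_self).trans
      (ev_pt_add_le (hG.nonneg i) ρ s (fun l => sev (T l) ρ) fun j => s * w j)
  have hF : ev (G i) (pt (ρ + s * t) ((fun l => sev (T l) ρ) + fun j => s * w j)) ≤ F i :=
    ev_mono _ (pt_mono (add_le_add_right hst _) fun j => le_rfl)
  refine hle.trans ?_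
  rw [← hT.sev_eq hG]
  refine add_le_add_right ?_ _ |>.trans' (le_of_eq (add_assoc _ _ _))
  calc _ ≤ t * (s * t * ev (MvPowerSeries.pderiv ℝ 0 (G i)) (pt ρ fun l => sev (T l) ρ) +
        ∑ j, s * w j * ev (partialY G i j) (pt ρ fun l => sev (T l) ρ)) + t ^ 2 * F i :=
        add_le_add_right (mul_le_mul_right hF _) _
    _ = t * (t * (s * ev (MvPowerSeries.pderiv ℝ 0 (G i)) (pt ρ fun l => sev (T l) ρ)) +
        s * ∑ j, w j * ev (partialY G i j) (pt ρ fun l => sev (T l) ρ) + t * F i) := by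
        rw [Finset.mul_sum]
        simp only [mul_assoc]
        ring
    _ ≤ t * (t * F i + s * ∑ j, w j * ev (partialY G i j) (pt ρ fun l => sev (T l) ρ) +
        t * F i) := by gcongr
    _ = t * (s * ∑ j, w j * ev (partialY G i j) (pt ρ fun l => sev (T l) ρ) + t * (2 * F i)) := by
        ring
    _ ≤ t * (s * w i) := mul_le_mul_right (ht i).le _

end Extreme

section Eigenpoint

theorem not_le_average {n : Type*} [Fintype n] [Nonempty n] {B C : Matrix n n ℝ} {u h : n → ℝ}
    (hu : ∀ i, 0 < u i) (hh : ∀ i, 0 < h i) (hBu : B.transpose.mulVec u = u)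
    (hCB : ∀ i j, C i j ≤ B i j) (hlt : ∃ i j, C i j < B i j)
    (hle : ∀ i, h i ≤ ∑ j, 2⁻¹ * h j * (B i j + C i j)) : False := by
  obtain ⟨i₀, j₀, h₀⟩ := hlt
  have hterm : ∀ i j, 2⁻¹ * h j * (B i j + C i j) ≤ h j * B i j := fun i j => by
    nlinarith [hCB i j, hh j]
  have hrow : ∀ i, ∑ j, 2⁻¹ * h j * (B i j + C i j) ≤ ∑ j, h j * B i j := fun i =>
    Finset.sum_le_sum fun j _ => hterm i j
  have h1 : ∑ i, u i * h i < ∑ i, u i * ∑ j, h j * B i j := by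
    refine Finset.sum_lt_sum
      (fun i _ => mul_le_mul_of_nonneg_left ((hle i).trans (hrow i)) (hu i).le)
      ⟨i₀, Finset.mem_univ _, mul_lt_mul_of_pos_left ((hle i₀).trans_lt ?_) (hu i₀)⟩
    refine Finset.sum_lt_sum (fun j _ => hterm i₀ j) ⟨j₀, Finset.mem_univ _, ?_⟩
    nlinarith [hh j₀]
  have h2 : ∑ i, u i * ∑ j, h j * B i j = ∑ j, u j * h j := by
    simp only [Finset.mul_sum]
    rw [Finset.sum_comm]
    refine Finset.sum_congr rfl fun j _ => ?_
    have := congrFun hBu j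
    simp only [Matrix.mulVec, dotProduct, Matrix.transpose_apply] at this
    conv_rhs => rw [← this]
    rw [Finset.sum_mul]
    exact Finset.sum_congr rfl fun i _ => by ring
  exact absurd h2 h1.ne'

variable {m : ℕ} {G : Fin m → MvPowerSeries (Fin (m + 1)) ℝ} {T : Fin m → PowerSeries ℝ}

/-- A solution of the system whose Jacobian matrix has a positive left eigenvector with
eigenvalue `1` lies on the standard solution. -/
theorem IsStandardSolution.eq_of_left_eigenvector (hG : IsWellConditioned G)
    (hT : IsStandardSolution G T) {a : ENNReal} {b : Fin m → ENNReal} (ha : a ≠ 0)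
    (hb : ∀ i, b i ≠ ⊤) (hsol : ∀ i, ev (G i) (pt a b) = b i)
    (hJ : ∀ i j, ev (partialY G i j) (pt a b) ≠ ⊤) {u : Fin m → ℝ} (hu : ∀ i, 0 < u i)
    (hu' : (Matrix.of fun i j => (ev (partialY G i j) (pt a b)).toReal).transpose.mulVec u = u)
    (i : Fin m) : sev (T i) a = b i := by
  have := hG.nonempty
  have hle : ∀ i, sev (T i) a ≤ b i := hT.sev_le hG fun i => (hsol i).le
  by_contra hne
  set t : Fin m → ENNReal := fun i => sev (T i) a
  set h : Fin m → ENNReal := fun i => b i - t i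
  have hth : t + h = b := funext fun i => add_tsub_cancel_of_le (hle i)
  have ht : ∀ i, t i ≠ ⊤ := fun i => ne_top_of_le_ne_top (hb i) (hle i)
  have ht0 : ∀ i, t i ≠ 0 := hT.sev_ne_zero hG ha
  have hh : ∀ i, h i ≠ ⊤ := fun i => ENNReal.sub_ne_top (hb i)
  have hbt : ∀ i, b i = t i + h i := fun i => (congrFun hth i).symm
  have htsol : ∀ i, ev (G i) (pt a t) = t i := fun i => (hT.sev_eq hG a i).symm
  have hsub : ∀ k l, ev (partialY G k l) (pt a t) * h l ≤ h k := fun k l => by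
    have h1 := ev_pt_add_sum_le (hG.nonneg k) a t h
    rw [hth, hsol, htsol, hbt] at h1
    refine le_trans ?_ ((ENNReal.add_le_add_iff_left (ht k)).1 h1)
    rw [mul_comm]
    exact Finset.single_le_sum (f := fun l => h l * ev (partialY G k l) (pt a t))
      (fun _ _ => zero_le) (Finset.mem_univ l)
  have hh0 : ∀ k, h k ≠ 0 := fun k => by
    have hpath : Relation.ReflTransGen (fun k l => ev (partialY G k l) (pt a t) ≠ 0) k i :=
      (hG.irreducible k i).lift id
        fun k l hkl => ev_ne_zero (hG.partialY_nonneg k l) hkl (pt_ne_zero ha ht0)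
    obtain ⟨C, hC, hCv⟩ := exists_path_bound hpath
    refine ne_bot_of_le_ne_bot (mul_ne_zero hC ?_) (hCv h hsub)
    exact (tsub_pos_of_lt (lt_of_le_of_ne (hle i) hne)).ne'
  set g : Fin m → ENNReal := fun i => 2⁻¹ * h i
  have hg0 : ∀ i, g i ≠ 0 := fun i => mul_ne_zero (by simp) (hh0 i)
  have hg' : ∀ i, g i ≠ ⊤ := fun i => ENNReal.mul_ne_top (by simp) (hh i)
  have hgg : t + g + g = b := by
    funext i
    rw [Pi.add_apply, Pi.add_apply, add_assoc, ← add_mul, ENNReal.inv_two_add_inv_two, one_mul,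
      hbt]
  have hcb : pt a (t + g) ≤ pt a b := pt_mono le_rfl fun i => by
    rw [← hgg]
    exact le_self_add
  have hJc : ∀ i j, ev (partialY G i j) (pt a (t + g)) ≠ ⊤ := fun i j =>
    ne_top_of_le_ne_top (hJ i j) (ev_mono _ hcb)
  refine not_le_average (B := Matrix.of fun i j => (ev (partialY G i j) (pt a b)).toReal)
    (C := Matrix.of fun i j => (ev (partialY G i j) (pt a (t + g))).toReal)
    (h := fun i => (h i).toReal) hu (fun i => ENNReal.toReal_pos (hh0 i) (hh i)) hu'
    (fun i j => ENNReal.toReal_mono (hJ i j) (ev_mono _ hcb)) ?_ fun i => ?_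
  · obtain ⟨i, j, k, hijk⟩ := hG.nonlinear
    refine ⟨i, j, ENNReal.toReal_strict_mono (hJ i j) ?_⟩
    have h1 := ev_pt_add_sum_le (hG.partialY_nonneg i j) a (t + g) g
    rw [hgg] at h1
    refine (ENNReal.lt_add_right (hJc i j) ?_).trans_le h1
    have h2 : ∀ l, (t + g) l ≠ 0 := fun l h => ht0 l (add_eq_zero.1 h).1
    refine ne_bot_of_le_ne_bot (mul_ne_zero (hg0 k) (ev_ne_zero
      (coeff_pderiv_nonneg (hG.partialY_nonneg i j) _) hijk (pt_ne_zero ha h2))) ?_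
    exact Finset.single_le_sum (f := fun l => g l *
      ev (MvPowerSeries.pderiv ℝ l.succ (partialY G i j)) (pt a (t + g)))
      (fun _ _ => zero_le) (Finset.mem_univ k)
  · have h1 := ev_pt_le_add (hG.nonneg i) a t g
    have h2 := ev_pt_le_add (hG.nonneg i) a (t + g) g
    rw [hgg, hsol] at h2
    rw [htsol] at h1
    have h3 := h2.trans (add_le_add_left h1 _)
    rw [hbt, add_assoc, ENNReal.add_le_add_iff_left (ht i), ← Finset.sum_add_distrib] at h3
    have hterm : ∀ j, g j * ev (partialY G i j) (pt a (t + g)) +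
        g j * ev (partialY G i j) (pt a b) ≠ ⊤ := fun j =>
      ENNReal.add_ne_top.2 ⟨ENNReal.mul_ne_top (hg' j) (hJc i j),
        ENNReal.mul_ne_top (hg' j) (hJ i j)⟩
    have h4 := ENNReal.toReal_mono (ENNReal.sum_ne_top.2 fun j _ => hterm j) h3
    rw [ENNReal.toReal_sum fun j _ => hterm j] at h4
    refine h4.trans (le_of_eq (Finset.sum_congr rfl fun j _ => ?_))
    have hgj : (g j).toReal = 2⁻¹ * (h j).toReal := by
      rw [ENNReal.toReal_mul, ENNReal.toReal_inv, ENNReal.toReal_ofNat]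
    rw [← mul_add, ENNReal.toReal_mul, ENNReal.toReal_add (hJc i j) (hJ i j), hgj, add_comm]
    rfl

end Eigenpoint

section Points

variable {m : ℕ} {G : Fin m → MvPowerSeries (Fin (m + 1)) ℝ} {p q : Fin (m + 1) → ℝ}

theorem ofReal_eq_pt (p : Fin (m + 1) → ℝ) :
    (fun i => ENNReal.ofReal (p i)) =
      pt (ENNReal.ofReal (p 0)) fun j => ENNReal.ofReal (p j.succ) := by
  funext i
  refine Fin.cases ?_ (fun j => ?_) i <;> simp [pt]

theorem evalNN_eq_ev_pt {A : MvPowerSeries (Fin (m + 1)) ℝ}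
    (hA : ∀ d, 0 ≤ MvPowerSeries.coeff d A) (hp : ∀ k, 0 < p k) :
    evalNN A p = ev A (pt (ENNReal.ofReal (p 0)) fun j => ENNReal.ofReal (p j.succ)) := by
  rw [evalNN_eq_ev hA fun i => (hp i).le, ofReal_eq_pt]

theorem IsWellConditioned.jacobian_apply (hG : IsWellConditioned G) (hp : ∀ k, 0 < p k)
    (i j : Fin m) : jacobian G p i j =
      (ev (partialY G i j) (pt (ENNReal.ofReal (p 0)) fun j => ENNReal.ofReal (p j.succ))).toReal := by
  rw [jacobian, Matrix.of_apply, evalNN_eq_ev_pt (hG.partialY_nonneg i j) hp]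

theorem IsWellConditioned.sum_mul_ev_partialY (hG : IsWellConditioned G) (hp : ∀ k, 0 < p k)
    (hJ : JacobianFinite G p) {v : Fin m → ℝ} (hv : ∀ i, 0 < v i) (i : Fin m) :
    ∑ j, ENNReal.ofReal (v j) * ev (partialY G i j)
      (pt (ENNReal.ofReal (p 0)) fun j => ENNReal.ofReal (p j.succ)) =
      ENNReal.ofReal ((jacobian G p).mulVec v i) := by
  have h0 : ∀ j, 0 ≤ jacobian G p i j := fun j => ENNReal.toReal_nonneg
  rw [Matrix.mulVec, dotProduct, ENNReal.ofReal_sum_of_nonneg fun j _ =>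
    mul_nonneg (h0 j) (hv j).le]
  refine Finset.sum_congr rfl fun j _ => ?_
  rw [ENNReal.ofReal_mul (h0 j), mul_comm, ← evalNN_eq_ev_pt
    (hG.partialY_nonneg i j) hp, jacobian, Matrix.of_apply, ENNReal.ofReal_toReal (hJ i j).ne]

theorem IsWellConditioned.exists_perron_jacobian (hG : IsWellConditioned G) (hp : ∀ k, 0 < p k)
    (hJ : JacobianFinite G p) :
    ∃ (r : ℝ) (v u : Fin m → ℝ), (∀ i, 0 < v i) ∧ (∀ i, 0 < u i) ∧
      (jacobian G p).mulVec v = r • v ∧ (jacobian G p).transpose.mulVec u = r • u ∧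
      IsGreatest {s : ℝ | Module.End.HasEigenvalue (Matrix.toLin' (jacobian G p)) s} r := by
  have := hG.nonempty
  refine exists_perron (fun i j => ENNReal.toReal_nonneg) fun i j => ?_
  refine (hG.irreducible i j).lift id fun k l hkl => ?_
  refine ENNReal.toReal_ne_zero.2 ⟨?_, (hJ k l).ne⟩
  rw [id, id, evalNN_eq_ev (hG.partialY_nonneg k l) fun i => (hp i).le]
  exact ev_ne_zero (hG.partialY_nonneg k l) hkl fun i => (ENNReal.ofReal_pos.2 (hp i)).ne'

theorem IsExtremePoint.exists_solution (hG : IsWellConditioned G) (h : IsExtremePoint G p) :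
    ∃ T, IsStandardSolution G T ∧ (∀ k, 0 < p k) ∧ (∀ i, radius (T i) = ENNReal.ofReal (p 0)) ∧
      ∀ i, sev (T i) (ENNReal.ofReal (p 0)) = ENNReal.ofReal (p i.succ) := by
  obtain ⟨T, hT, h0, hp⟩ := h
  obtain ⟨ρ, hρ0, -, hrad, -⟩ := hT.exists_radius hG
  obtain ⟨i₀⟩ := hG.nonempty
  have hρ : ENNReal.ofReal (p 0) = ρ := by rw [← (hp i₀).1, hrad]
  have hfin : ∀ i, sev (T i) (ENNReal.ofReal (p 0)) ≠ ⊤ := fun i =>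
    sev_ne_top_of_summable (hT.nonneg i) h0 (hp i).2.summable
  have hval : ∀ i, p i.succ = (sev (T i) (ENNReal.ofReal (p 0))).toReal := fun i =>
    (hp i).2.unique (hasSum_of_sev_ne_top (hT.nonneg i) h0 (hfin i))
  refine ⟨T, hT, fun k => ?_, fun i => (hp i).1, fun i => ?_⟩
  · refine Fin.cases ?_ (fun i => ?_) k
    · exact ENNReal.ofReal_pos.1 (hρ ▸ pos_iff_ne_zero.2 hρ0)
    · rw [hval]
      exact ENNReal.toReal_pos (hT.sev_ne_zero hG (hρ ▸ hρ0) i) (hfin i)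
  · rw [hval, ENNReal.ofReal_toReal (hfin i)]

theorem exists_isExtremePoint (hG : IsWellConditioned G) : ∃ p, IsExtremePoint G p := by
  obtain ⟨T, hT⟩ := exists_isStandardSolution hG
  obtain ⟨ρ, -, hρ, hrad, hfin⟩ := hT.exists_radius hG
  refine ⟨Fin.cons ρ.toReal fun i => (sev (T i) ρ).toReal, T, hT, ?_, fun i => ?_⟩
  · exact ENNReal.toReal_nonneg
  · simp only [Fin.cons_zero, Fin.cons_succ]
    rw [ENNReal.ofReal_toReal hρ]
    refine ⟨hrad i, ?_⟩
    have := hasSum_of_sev_ne_top (hT.nonneg i) (x := ρ.toReal) ENNReal.toReal_nonneg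
      (by rw [ENNReal.ofReal_toReal hρ]; exact hfin i)
    rwa [ENNReal.ofReal_toReal hρ] at this

theorem IsExtremePoint.unique (hG : IsWellConditioned G) (hp : IsExtremePoint G p)
    (hq : IsExtremePoint G q) : p = q := by
  obtain ⟨T, hT, hp0, hprad, hpval⟩ := hp.exists_solution hG
  obtain ⟨S, hS, hq0, hqrad, hqval⟩ := hq.exists_solution hG
  obtain rfl := hT.unique hG hS
  obtain ⟨i₀⟩ := hG.nonempty
  have h0 : p 0 = q 0 := by
    rw [← ENNReal.ofReal_eq_ofReal_iff (hp0 0).le (hq0 0).le, ← hprad i₀, hqrad i₀]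
  funext k
  refine Fin.cases h0 (fun i => ?_) k
  rw [← ENNReal.ofReal_eq_ofReal_iff (hp0 _).le (hq0 _).le, ← hpval, ← hqval, h0]

theorem IsExtremePoint.jacobianFinite (hG : IsWellConditioned G) (h : IsExtremePoint G p) :
    JacobianFinite G p := by
  obtain ⟨T, hT, hp, -, hval⟩ := h.exists_solution hG
  intro i j
  rw [evalNN_eq_ev_pt (hG.partialY_nonneg i j) hp, lt_top_iff_ne_top]
  simp only [← hval]
  exact hT.ev_partialY_ne_top hG (ENNReal.ofReal_pos.2 (hp 0)).ne'
    (fun i => by rw [hval]; exact ENNReal.ofReal_ne_top) i j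

theorem IsExtremePoint.evalNN_eq (hG : IsWellConditioned G) (h : IsExtremePoint G p) (i : Fin m) :
    evalNN (G i) p = ENNReal.ofReal (p i.succ) := by
  obtain ⟨T, hT, hp, -, hval⟩ := h.exists_solution hG
  rw [evalNN_eq_ev_pt (hG.nonneg i) hp]
  simp only [← hval]
  exact (hT.sev_eq hG _ i).symm

theorem IsExtremePoint.mem_posDomain (hG : IsWellConditioned G) (h : IsExtremePoint G p) :
    p ∈ posDomain G := by
  obtain ⟨T, hT, hp, -, hval⟩ := h.exists_solution hG
  exact ⟨hp, fun i => by rw [h.evalNN_eq hG]; exact ENNReal.ofReal_lt_top⟩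

theorem IsExtremePoint.eigenvalue_le_one (hG : IsWellConditioned G) (h : IsExtremePoint G p)
    {r : ℝ} {v : Fin m → ℝ} (hv : ∀ i, 0 < v i) (hr : (jacobian G p).mulVec v = r • v) :
    r ≤ 1 := by
  obtain ⟨T, hT, hp, -, hval⟩ := h.exists_solution hG
  obtain ⟨i, hi⟩ := hT.exists_sum_mul_ev_partialY_le hG (ENNReal.ofReal_pos.2 (hp 0)).ne'
    (fun i => by rw [hval]; exact ENNReal.ofReal_ne_top) (w := fun i => ENNReal.ofReal (v i))
    (fun i => (ENNReal.ofReal_pos.2 (hv i)).ne') fun i => ENNReal.ofReal_ne_top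
  simp only [hval] at hi
  rw [hG.sum_mul_ev_partialY hp (h.jacobianFinite hG) hv, hr,
    ENNReal.ofReal_le_ofReal_iff (hv i).le, Pi.smul_apply, smul_eq_mul] at hi
  exact le_of_mul_le_mul_right (by rwa [one_mul]) (hv i)

theorem IsExtremePoint.isEigenpoint (hG : IsWellConditioned G) (h : IsExtremePoint G p)
    (hlam : IsLambda G p 1) : IsEigenpoint G p := by
  refine ⟨⟨(h.mem_posDomain hG).1, h.evalNN_eq hG, hlam.1, ?_⟩, hlam⟩
  obtain ⟨z, hz⟩ := Module.End.HasEigenvalue.exists_hasEigenvector hlam.2.1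
  refine Matrix.exists_mulVec_eq_zero_iff.1 ⟨z, hz.2, ?_⟩
  have := hz.apply_eq_smul
  rw [Matrix.toLin'_apply, one_smul] at this
  rw [Matrix.sub_mulVec, Matrix.one_mulVec, this, sub_self]

theorem IsExtremePoint.one_le_eigenvalue (hG : IsWellConditioned G) (h : IsExtremePoint G p)
    (hint : p ∈ interior (posDomain G)) {r : ℝ} {v : Fin m → ℝ} (hv : ∀ i, 0 < v i)
    (hr : (jacobian G p).mulVec v = r • v) : 1 ≤ r := by
  by_contra! hlt
  obtain ⟨T, hT, hp, hrad, hval⟩ := h.exists_solution hG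
  have hcont : Continuous fun s : ℝ => p + s • (Fin.cons 1 v : Fin (m + 1) → ℝ) := by fun_prop
  have hev : ∀ᶠ s : ℝ in 𝓝[>] 0, p + s • (Fin.cons 1 v : Fin (m + 1) → ℝ) ∈ posDomain G := by
    refine nhdsWithin_le_nhds (hcont.continuousAt.eventually_mem ?_)
    rw [zero_smul, add_zero]
    exact mem_interior_iff_mem_nhds.1 hint
  obtain ⟨s, hs, hspos⟩ := (hev.and self_mem_nhdsWithin).exists
  have hspos : 0 < s := hspos
  obtain ⟨y, hy, hy', hfin⟩ := hT.exists_gt_sev_ne_top hG (ρ := ENNReal.ofReal (p 0))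
    (s := ENNReal.ofReal s) (w := fun i => ENNReal.ofReal (v i)) ENNReal.ofReal_ne_top
    (ENNReal.ofReal_pos.2 hspos).ne' ENNReal.ofReal_ne_top
    (fun i => by rw [hval]; exact ENNReal.ofReal_ne_top) (fun i => ENNReal.ofReal_ne_top)
    (fun i => by
      have := (hs.2 i).ne
      rw [evalNN_eq_ev_pt (hG.nonneg i) hs.1] at this
      simp only [Pi.add_apply, Pi.smul_apply, Fin.cons_zero, Fin.cons_succ, smul_eq_mul,
        mul_one] at this
      simpa only [hval, ENNReal.ofReal_add (hp _).le hspos.le,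
        ENNReal.ofReal_add (hp _).le (mul_pos hspos (hv _)).le,
        ENNReal.ofReal_mul hspos.le] using this)
    (fun i => by
      simp only [hval]
      rw [hG.sum_mul_ev_partialY hp (h.jacobianFinite hG) hv, hr,
        ENNReal.ofReal_lt_ofReal_iff (hv i), Pi.smul_apply, smul_eq_mul]
      exact mul_lt_of_lt_one_left (hv i) hlt)
  obtain ⟨i₀⟩ := hG.nonempty
  have := le_radius_of_sev_ne_top (hT.nonneg i₀) hy' (hfin i₀)
  rw [hrad] at this
  exact absurd hy (not_lt.2 this)

theorem IsEigenpoint.eq_extremePoint (hG : IsWellConditioned G) (hq : IsEigenpoint G q)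
    (hp : IsExtremePoint G p) : q = p := by
  obtain ⟨T, hT, hp0, hrad, hval⟩ := hp.exists_solution hG
  obtain ⟨⟨hq0, hsol, hJ, -⟩, -, hgreatest⟩ := hq
  obtain ⟨r, v, u, hv, hu, hrv, hru, hr⟩ := hG.exists_perron_jacobian hq0 hJ
  obtain rfl := hr.unique hgreatest
  rw [one_smul] at hrv hru
  have ha : ENNReal.ofReal (q 0) ≠ 0 := (ENNReal.ofReal_pos.2 (hq0 0)).ne'
  have hqval : ∀ i, sev (T i) (ENNReal.ofReal (q 0)) = ENNReal.ofReal (q i.succ) := by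
    refine hT.eq_of_left_eigenvector hG ha (fun i => ENNReal.ofReal_ne_top)
      (fun i => by rw [← evalNN_eq_ev_pt (hG.nonneg i) hq0, hsol])
      (fun i j => by rw [← evalNN_eq_ev_pt (hG.partialY_nonneg i j) hq0]; exact (hJ i j).ne) hu ?_
    convert hru using 3
    ext i j
    rw [hG.jacobian_apply hq0, Matrix.of_apply]
  have := hG.nonempty
  have h0 : ENNReal.ofReal (q 0) = ENNReal.ofReal (p 0) := by
    obtain ⟨i₀⟩ := hG.nonempty
    refine le_antisymm ?_ (not_lt.1 fun hlt => ?_)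
    · rw [← hrad i₀]
      refine le_radius_of_sev_ne_top (hT.nonneg i₀) ENNReal.ofReal_ne_top ?_
      rw [hqval]
      exact ENNReal.ofReal_ne_top
    · have hfin : ∀ i, sev (T i) (ENNReal.ofReal (p 0)) ≠ ⊤ := fun i => by
        rw [hval]
        exact ENNReal.ofReal_ne_top
      refine not_subinvariant (hT.sum_increment_lt hG ha hlt hfin)
        (fun i => ENNReal.sub_ne_top (hfin i)) (w := fun i => ENNReal.ofReal (v i))
        (fun i => (ENNReal.ofReal_pos.2 (hv i)).ne') (fun i => ENNReal.ofReal_ne_top) fun i => ?_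
      simp only [hqval]
      rw [hG.sum_mul_ev_partialY hq0 hJ hv, hrv]
  funext k
  refine Fin.cases ((ENNReal.ofReal_eq_ofReal_iff (hq0 0).le (hp0 0).le).1 h0) (fun i => ?_) k
  rw [← ENNReal.ofReal_eq_ofReal_iff (hq0 _).le (hp0 _).le, ← hval, ← hqval, h0]

end Points

end RecursiveSystem

end

theorem mainTheorem1 {m : ℕ} (G : Fin m → MvPowerSeries (Fin (m + 1)) ℝ)
    (hG : RecursiveSystem.IsWellConditioned G) :
    (∃! p : Fin (m + 1) → ℝ, RecursiveSystem.IsExtremePoint G p) ∧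
    ∀ p : Fin (m + 1) → ℝ, RecursiveSystem.IsExtremePoint G p →
      p ∈ RecursiveSystem.posDomain G ∧
      (p ∈ interior (RecursiveSystem.posDomain G) → RecursiveSystem.IsEigenpoint G p) ∧
      {q | RecursiveSystem.IsEigenpoint G q}.Subsingleton ∧
      (∀ q, RecursiveSystem.IsEigenpoint G q → q = p) ∧
      ((¬ ∃ q, RecursiveSystem.IsEigenpoint G q) →
        p ∈ frontier (RecursiveSystem.posDomain G) ∧
          ∃ l : ℝ, RecursiveSystem.IsLambda G p l ∧ l < 1) := by
  obtain ⟨p₀, hp₀⟩ := RecursiveSystem.exists_isExtremePoint hG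
  refine ⟨⟨p₀, hp₀, fun q hq => hq.unique hG hp₀⟩, fun p hp => ?_⟩
  have hdom := hp.mem_posDomain hG
  have hJ := hp.jacobianFinite hG
  obtain ⟨r, v, u, hv, -, hrv, -, hr⟩ := hG.exists_perron_jacobian hdom.1 hJ
  have hr1 := hp.eigenvalue_le_one hG hv hrv
  have hint : p ∈ interior (RecursiveSystem.posDomain G) → RecursiveSystem.IsEigenpoint G p :=
    fun h => by
      obtain rfl := le_antisymm hr1 (hp.one_le_eigenvalue hG h hv hrv)
      exact hp.isEigenpoint hG ⟨hJ, hr⟩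
  refine ⟨hdom, hint, fun q hq q' hq' => ?_, fun q hq => hq.eq_extremePoint hG hp, fun hno => ?_⟩
  · exact (RecursiveSystem.IsEigenpoint.eq_extremePoint hG hq hp).trans
      (RecursiveSystem.IsEigenpoint.eq_extremePoint hG hq' hp).symm
  · refine ⟨⟨subset_closure hdom, fun h => hno ⟨p, hint h⟩⟩, r, ⟨hJ, hr⟩, ?_⟩
    refine lt_of_le_of_ne hr1 fun h => hno ⟨p, hp.isEigenpoint hG ?_⟩
    exact h ▸ ⟨hJ, hr⟩
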